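/- For $k\in\{0,1,2,\dots\}$ let $\mathbf 2^k=\{0,1\}^k\subset\mathbb Z^k$, and for $s\in\mathbb R$ put $$\mathbf 2^k_{<s}=\Big\{x\in\mathbf 2^k:\sum_{i=1}^k x_i<s\Big\},\qquad \mathbf 2^k_{>s}=\Big\{x\in\mathbf 2^k:\sum_{i=1}^k x_i>s\Big\}.$$ The $\binom ks$-sandwich is the subset $$\Xi^k_s=\big(\{-1\}\times\mathbf 2^k_{<s}\big)\cup\big(\{0\}\times\mathbf 2^k_{<k}\big)\cup\big(\{1\}\times\mathbf 2^k_{>s}\big)$$ of the discrete group $\mathbb Z\times\mathbb Z^k$. A subset $C$ of a topological group $G$, written additively, is called $n$-centerpole if for every coloring $\chi:G\to\{0,\dots,n-1\}$ there are an unbounded monochromatic set $S\subset G$ and a point $c\in C$ such that $S-c=c-S$; here a set is unbounded if for some neighborhood $U$ of the neutral element it is not covered by finitely many left shifts of $U$ (in the discrete group $\mathbb Z\times\mathbb Z^k$ this means that it is infinite). Theorem. For every integer $k\ge 0$ and every real number (in particular, every integer) $s\le k-2$, the sandwich $\Xi^k_s$ is $(k+1)$-centerpole in $\mathbb Z\times\mathbb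 Z^k$, and it has exactly $$|\Xi^k_s|=2^{k+1}-1-\binom ks$$ points, where $\binom ks=\frac{k!}{s!\,(k-s)!}$ if $s\in\{0,1,\dots,k\}$ and $\binom ks=0$ otherwise. -/

import Mathlib

/-- A subset `B` of a topological group `G` (written additively) is totally bounded if for every
neighborhood `U` of the neutral element, finitely many left shifts of `U` cover `B`. -/
def IsGroupTotallyBounded {G : Type*} [AddGroup G] [TopologicalSpace G] (B : Set G) : Prop :=
  ∀ U ∈ nhds (0 : G), ∃ F : Set G, F.Finite ∧ B ⊆ ⋃ g ∈ F, (fun u => g + u) '' U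

/-- A subset of a topological group is unbounded if it is not totally bounded. -/
def IsGroupUnbounded {G : Type*} [AddGroup G] [TopologicalSpace G] (B : Set G) : Prop :=
  ¬ IsGroupTotallyBounded B

/-- `S` is symmetric with respect to the point `c`: `S - c = c - S`. -/
def IsSymmetricAbout {G : Type*} [AddGroup G] (S : Set G) (c : G) : Prop :=
  (fun x => x - c) '' S = (fun x => c - x) '' S

/-- `S` is monochromatic for the coloring `χ`: all its points have one color. -/
def IsMonochromatic {G : Type*} {n : ℕ} (χ : G → Fin n) (S : Set G) : Prop :=
  ∃ i : Fin n, ∀ x ∈ S, χ x = i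

/-- `C` is `n`-centerpole in the topological group `G`: for every `n`-coloring of `G` there is an
unbounded monochromatic subset of `G` that is symmetric with respect to some point of `C`. -/
def IsCenterpole {G : Type*} [AddGroup G] [TopologicalSpace G] (n : ℕ) (C : Set G) : Prop :=
  ∀ χ : G → Fin n, ∃ S : Set G, ∃ c ∈ C,
    IsGroupUnbounded S ∧ IsMonochromatic χ S ∧ IsSymmetricAbout S c

/-- The discrete cube `{0,1}^k` inside `ℤ^k`. -/
def discreteCube (k : ℕ) : Set (Fin k → ℤ) :=
  {x | ∀ i, x i = 0 ∨ x i = 1}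

/-- The slice of the cube consisting of the points with coordinate sum `< s`. -/
def lowerSlice (k : ℕ) (s : ℝ) : Set (Fin k → ℤ) :=
  {x | x ∈ discreteCube k ∧ ((∑ i, x i : ℤ) : ℝ) < s}

/-- The slice of the cube consisting of the points with coordinate sum `> s`. -/
def upperSlice (k : ℕ) (s : ℝ) : Set (Fin k → ℤ) :=
  {x | x ∈ discreteCube k ∧ s < ((∑ i, x i : ℤ) : ℝ)}

/-- The `(k choose s)`-sandwich in the group `ℤ × ℤ^k`. -/
def sandwich (k : ℕ) (s : ℝ) : Set (ℤ × (Fin k → ℤ)) :=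
  ({-1} ×ˢ lowerSlice k s) ∪ ({0} ×ˢ lowerSlice k (k : ℝ)) ∪ ({1} ×ˢ upperSlice k s)

open Classical in
/-- The binomial coefficient with a real lower entry: it is the usual `(k choose s)` if `s` is one
of the numbers `0, …, k`, and zero otherwise. -/
noncomputable def binom (k : ℕ) (s : ℝ) : ℕ :=
  if s = (⌊s⌋₊ : ℝ) then k.choose ⌊s⌋₊ else 0

/-! Suppose that a coloring `χ` admits no unbounded monochromatic set symmetric about a point of the
sandwich. Then for each of the finitely many centers `c` only finitely many `x` satisfy `χ x = χ (2c
- x)`. For the doubled coloring `u ↦ χ (2u)` this says that, far from the origin, `u + v` in the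
sandwich forces different colors of `u` and `v` (`SeparatesSandwich`). With `k + 1` colors this is
refuted by a parity count of rainbow simplices.

The coloring on the layers `≥ 0` is transported to the lexicographically positive points of
`ℤ^(k+1)` and extended evenly to the negative ones; `lexSide` tells a point from its antipode. On
the boundary of a large cube `[-R, R]^(k+1)` with its Kuhn triangulation, no edge joins points of
equal color on opposite sides: such an edge would yield two equally colored points whose sum lies in
the middle layer of the sandwich. Hence Ky Fan's theorem applies. Its hemisphere form
`IsFanLabelling.hemisphere` is derived from the cochain identity `coboundary_alternating` and a mod
2 Stokes formula. When all `k + 1` colors occur, the signs `lexSide + color` alternate, with the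
right starting sign, exactly on the rainbow simplices all of whose vertices are positive. So there
is an odd number of signed pairs on the upper hemisphere, which consists of the lateral sides and
the cap `v 0 = R`.

The sides contribute nothing: the vertices of each of their simplices have a common neighbor
(`exists_common_neighbor`), whose color they all avoid. The cap is a union of unit `k`-cubes, and
each of them contains an even number of rainbow Kuhn simplices (`sum_rainbow_kuhnSimplex`): three
families of its vertices have common neighbors, hence miss a color. Odd equals even, a
contradiction. The bound `s ≤ k - 2` is what places the two highest levels of the cube in the upper
slice.

The cardinality follows by splitting the cube into the points with sum below, above and equal to
`s`. -/

/-! ### Mod 2 cochains and Fan's alternating cochain -/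

/-- The mod 2 coboundary of a cochain on finite sets. -/
def coboundary {V : Type*} [DecidableEq V] (f : Finset V → ZMod 2) (σ : Finset V) : ZMod 2 :=
  ∑ v ∈ σ, f (σ.erase v)

theorem coboundary_coboundary {V : Type*} [DecidableEq V] (f : Finset V → ZMod 2) (σ : Finset V) :
    coboundary (coboundary f) σ = 0 := by
  unfold coboundary
  rw [Finset.sum_sigma']
  refine Finset.sum_involution (fun p _ => ⟨p.2, p.1⟩) ?_ ?_ ?_ ?_
  · rintro ⟨v, u⟩ _
    simp only
    rw [Finset.erase_right_comm]
    exact CharTwo.add_self_eq_zero _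
  · rintro ⟨v, u⟩ h _ he
    simp only [Finset.mem_sigma, Finset.mem_erase] at h
    simp only [Sigma.mk.injEq] at he
    exact h.2.1 he.1
  · rintro ⟨v, u⟩ h
    simp only [Finset.mem_sigma, Finset.mem_erase] at h ⊢
    exact ⟨h.2.2, Ne.symm h.2.1, h.1⟩
  · rintro ⟨v, u⟩ _
    rfl

theorem coboundary_add {V : Type*} [DecidableEq V] (f g : Finset V → ZMod 2) (σ : Finset V) :
    coboundary (fun τ => f τ + g τ) σ = coboundary f σ + coboundary g σ :=
  Finset.sum_add_distrib

theorem coboundary_image {V W : Type*} [DecidableEq V] [DecidableEq W] (f : Finset W → ZMod 2)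
    (φ : V → W) (hφ : Function.Injective φ) (σ : Finset V) :
    coboundary (fun τ => f (τ.image φ)) σ = coboundary f (σ.image φ) := by
  unfold coboundary
  rw [Finset.sum_image (fun _ _ _ _ h => hφ h)]
  exact Finset.sum_congr rfl fun v _ => by simp only [Finset.image_erase hφ]

/-- The cochain of alternating sets: `alternating c ε N b σ` is `1` if the colors `c` of the points
of `σ` are distinct and smaller than `N`, and the signs `ε`, read from the largest color downwards,
alternate and start with `b`; it is `0` otherwise. -/
def alternating {V : Type*} [DecidableEq V] (c : V → ℕ) (ε : V → ZMod 2) :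
    ℕ → ZMod 2 → Finset V → ZMod 2
  | 0, _, σ => if σ = ∅ then 1 else 0
  | N + 1, b, σ => alternating c ε N b σ +
      ∑ v ∈ σ, if c v = N ∧ ε v = b then alternating c ε N (b + 1) (σ.erase v) else 0

section alternating

variable {V : Type*} [DecidableEq V] (c : V → ℕ) (ε : V → ZMod 2)

theorem alternating_empty (N : ℕ) (b : ZMod 2) : alternating c ε N b ∅ = 1 := by
  induction N generalizing b with
  | zero => simp [alternating]
  | succ N ih => simp [alternating, ih]

variable {c ε}

theorem alternating_eq_zero_of_le {N : ℕ} {b : ZMod 2} {σ : Finset V} {v : V} (hv : v ∈ σ)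
    (h : N ≤ c v) : alternating c ε N b σ = 0 := by
  induction N generalizing b σ with
  | zero => simp [alternating, Finset.ne_empty_of_mem hv]
  | succ N ih =>
    rw [alternating, ih hv (by omega), zero_add]
    refine Finset.sum_eq_zero fun u hu => ?_
    split_ifs with hc
    · refine ih (Finset.mem_erase.2 ⟨?_, hv⟩) (by omega)
      rintro rfl
      omega
    · rfl

theorem alternating_succ_of_ne {N : ℕ} {b : ZMod 2} {σ : Finset V} (h : ∀ v ∈ σ, c v ≠ N) :
    alternating c ε (N + 1) b σ = alternating c ε N b σ := by
  rw [alternating, Finset.sum_eq_zero, add_zero]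
  intro v hv
  simp [h v hv]

theorem alternating_succ_of_unique {N : ℕ} {b : ZMod 2} {σ : Finset V} {v : V} (hv : v ∈ σ)
    (hc : c v = N) (h : ∀ u ∈ σ, u ≠ v → c u ≠ N) :
    alternating c ε (N + 1) b σ = if ε v = b then alternating c ε N (b + 1) (σ.erase v) else 0 := by
  rw [alternating, alternating_eq_zero_of_le hv hc.ge, zero_add, Finset.sum_eq_single v]
  · simp [hc]
  · intro u hu huv
    simp [h u hu huv]
  · exact fun h => absurd hv h

theorem alternating_succ_of_two {N : ℕ} {b : ZMod 2} {σ : Finset V} {u v : V} (hu : u ∈ σ)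
    (hv : v ∈ σ) (huv : u ≠ v) (hcu : c u = N) (hcv : c v = N) :
    alternating c ε (N + 1) b σ = 0 := by
  rw [alternating, alternating_eq_zero_of_le hu hcu.ge, zero_add]
  refine Finset.sum_eq_zero fun x hx => ?_
  split_ifs with h
  · by_cases hxu : x = u
    · exact alternating_eq_zero_of_le (Finset.mem_erase.2 ⟨by rw [hxu]; exact huv.symm, hv⟩) hcv.ge
    · exact alternating_eq_zero_of_le (Finset.mem_erase.2 ⟨Ne.symm hxu, hu⟩) hcu.ge
  · rfl

theorem zmod_two_add_one_add_one (b : ZMod 2) : b + 1 + 1 = b := by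
  rw [add_assoc, CharTwo.add_self_eq_zero, add_zero]

theorem zmod_two_eq_add_one_iff (a b : ZMod 2) : a = b + 1 ↔ a ≠ b := by
  revert a b; decide

/-- Fan's formula for the coboundary of the alternating cochain. -/
theorem coboundary_alternating {N : ℕ} {b : ZMod 2} {σ : Finset V} (hσ : σ.Nonempty)
    (hN : ∀ v ∈ σ, c v < N) (hc : ∀ u ∈ σ, ∀ v ∈ σ, c u = c v → ε u = ε v) :
    coboundary (alternating c ε N b) σ = alternating c ε N b σ + alternating c ε N (b + 1) σ := by
  induction N generalizing b σ with
  | zero =>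
    obtain ⟨v, hv⟩ := hσ
    exact absurd (hN v hv) (by omega)
  | succ N ih =>
    by_cases h0 : ∀ v ∈ σ, c v ≠ N
    · rw [alternating_succ_of_ne h0, alternating_succ_of_ne h0,
        ← ih hσ (fun v hv => by have := hN v hv; have := h0 v hv; omega) hc]
      exact Finset.sum_congr rfl fun v _ =>
        alternating_succ_of_ne fun u hu => h0 u (Finset.mem_of_mem_erase hu)
    push Not at h0
    obtain ⟨v, hv, hcv⟩ := h0
    by_cases h1 : ∀ u ∈ σ, u ≠ v → c u ≠ N
    · have hlt : ∀ u ∈ σ.erase v, c u < N := fun u hu => by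
        have h := Finset.mem_erase.1 hu
        have := hN u h.2
        have := h1 u h.2 h.1
        omega
      have key : coboundary (alternating c ε (N + 1) b) σ = alternating c ε N b (σ.erase v) +
          if ε v = b then coboundary (alternating c ε N (b + 1)) (σ.erase v) else 0 := by
        unfold coboundary
        rw [← Finset.add_sum_erase _ _ hv, alternating_succ_of_ne fun u hu => (hlt u hu).ne]
        congr 1
        have : ∀ u ∈ σ.erase v, alternating c ε (N + 1) b (σ.erase u) =
            if ε v = b then alternating c ε N (b + 1) ((σ.erase v).erase u) else 0 := by
          intro u hu
          have h := Finset.mem_erase.1 hu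
          rw [alternating_succ_of_unique (Finset.mem_erase.2 ⟨h.1.symm, hv⟩) hcv
            (fun x hx hxv => h1 x (Finset.mem_of_mem_erase hx) hxv), Finset.erase_right_comm]
        rw [Finset.sum_congr rfl this]
        split_ifs <;> simp
      rw [key, alternating_succ_of_unique hv hcv h1, alternating_succ_of_unique hv hcv h1,
        zmod_two_add_one_add_one]
      -- If `v` has the starting sign, the induction hypothesis for `σ.erase v` produces a second
      -- copy of `alternating c ε N b (σ.erase v)`, which cancels the first one mod 2.
      by_cases hb : ε v = b
      · have hb' : ¬ ε v = b + 1 := by rw [zmod_two_eq_add_one_iff]; simpa using hb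
        rw [if_pos hb, if_pos hb, if_neg hb', add_zero]
        rcases (σ.erase v).eq_empty_or_nonempty with he | hne
        · simp [he, coboundary, alternating_empty]
        · rw [ih hne hlt fun x hx y hy => hc x (Finset.mem_of_mem_erase hx) y
            (Finset.mem_of_mem_erase hy), zmod_two_add_one_add_one, add_comm (alternating c ε N (b + 1) _),
            ← add_assoc, CharTwo.add_self_eq_zero, zero_add]
      · rw [if_neg hb, if_neg hb, if_pos ((zmod_two_eq_add_one_iff _ _).2 hb), add_zero, zero_add]
    · push Not at h1
      obtain ⟨u, hu, huv, hcu⟩ := h1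
      rw [alternating_succ_of_two hu hv huv hcu hcv, alternating_succ_of_two hu hv huv hcu hcv,
        add_zero]
      unfold coboundary
      have hu' : u ∈ σ.erase v := Finset.mem_erase.2 ⟨huv, hu⟩
      have hv' : v ∈ σ.erase u := Finset.mem_erase.2 ⟨huv.symm, hv⟩
      rw [← Finset.add_sum_erase _ _ hv, ← Finset.add_sum_erase _ _ hu', ← add_assoc,
        Finset.sum_eq_zero, add_zero]
      -- Only the facets opposite `u` and `v` can be alternating. Without a third vertex of color
      -- `N` they contribute equally, since `u` and `v` carry the same color and, by `hc`, the same
      -- sign.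
      · by_cases h2 : ∃ x ∈ σ, x ≠ u ∧ x ≠ v ∧ c x = N
        · obtain ⟨x, hx, hxu, hxv, hcx⟩ := h2
          rw [alternating_succ_of_two hu' (Finset.mem_erase.2 ⟨hxv, hx⟩) hxu.symm hcu hcx,
            alternating_succ_of_two hv' (Finset.mem_erase.2 ⟨hxu, hx⟩) hxv.symm hcv hcx, add_zero]
        · push Not at h2
          rw [alternating_succ_of_unique hu' hcu fun x hx hxu =>
              h2 x (Finset.mem_of_mem_erase hx) hxu (Finset.ne_of_mem_erase hx),
            alternating_succ_of_unique hv' hcv fun x hx hxv =>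
              h2 x (Finset.mem_of_mem_erase hx) (Finset.ne_of_mem_erase hx) hxv,
            hc u hu v hv (hcu.trans hcv.symm), Finset.erase_right_comm]
          exact CharTwo.add_self_eq_zero _
      · intro x hx
        have h := Finset.mem_erase.1 hx
        have h' := Finset.mem_erase.1 h.2
        exact alternating_succ_of_two (Finset.mem_erase.2 ⟨h.1.symm, hu⟩)
          (Finset.mem_erase.2 ⟨h'.1.symm, hv⟩) huv hcu hcv

/-- When all `N` colors occur, sign and color both change parity from one color to the next, so `ε +
c` is constant; its value is read off at the top color `N - 1`, whose sign is `b`. -/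
theorem alternating_full {N : ℕ} {b : ZMod 2} {σ : Finset V} (h : alternating c ε N b σ ≠ 0) :
    σ.card ≤ N ∧ Set.InjOn c σ ∧ (σ.card = N → ∀ v ∈ σ, ε v + c v = b + N + 1) := by
  induction N generalizing b σ with
  | zero =>
    have : σ = ∅ := by
      by_contra hne
      simp [alternating, hne] at h
    subst this
    simp
  | succ N ih =>
    by_cases h0 : ∀ v ∈ σ, c v ≠ N
    · rw [alternating_succ_of_ne h0] at h
      have := ih h
      exact ⟨by omega, this.2.1, fun _ => by omega⟩
    push Not at h0
    obtain ⟨v, hv, hcv⟩ := h0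
    by_cases h1 : ∀ u ∈ σ, u ≠ v → c u ≠ N
    · rw [alternating_succ_of_unique hv hcv h1] at h
      split_ifs at h with hb
      · obtain ⟨i1, i2, i3⟩ := ih h
        have hcard := Finset.card_erase_add_one hv
        refine ⟨by omega, ?_, fun hN u hu => ?_⟩
        · intro x hx y hy hxy
          by_cases hxv : x = v
          · by_contra hne
            exact h1 y hy (by rintro rfl; exact hne hxv) (by rw [← hxy, hxv, hcv])
          by_cases hyv : y = v
          · by_contra hne
            exact h1 x hx hxv (by rw [hxy, hyv, hcv])
          exact i2 (Finset.mem_coe.2 (Finset.mem_erase.2 ⟨hxv, hx⟩)) (Finset.mem_coe.2 (Finset.mem_erase.2 ⟨hyv, hy⟩)) hxy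
        · by_cases huv : u = v
          · subst huv
            rw [hb, hcv]
            push_cast
            rw [add_assoc, add_assoc, CharTwo.add_self_eq_zero, add_zero]
          · rw [i3 (by omega) u (Finset.mem_erase.2 ⟨huv, hu⟩)]
            push_cast
            ring
      · exact absurd rfl h
    · push Not at h1
      obtain ⟨u, hu, huv, hcu⟩ := h1
      exact absurd (alternating_succ_of_two hu hv huv hcu hcv) h

theorem alternating_eq_one {N : ℕ} {b : ZMod 2} {σ : Finset V} (hcard : σ.card = N)
    (hN : ∀ v ∈ σ, c v < N) (hinj : Set.InjOn c σ) (hε : ∀ v ∈ σ, ε v + c v = b + N + 1) :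
    alternating c ε N b σ = 1 := by
  induction N generalizing b σ with
  | zero => rw [Finset.card_eq_zero.1 hcard, alternating_empty]
  | succ N ih =>
    have : N ∈ σ.image c := by
      have h : σ.image c = Finset.range (N + 1) := by
        refine Finset.eq_of_subset_of_card_le ?_ ?_
        · intro x hx
          obtain ⟨v, hv, rfl⟩ := Finset.mem_image.1 hx
          exact Finset.mem_range.2 (hN v hv)
        · rw [Finset.card_image_of_injOn hinj, hcard, Finset.card_range]
      rw [h]
      simp
    obtain ⟨v, hv, hcv⟩ := Finset.mem_image.1 this
    have h1 : ∀ u ∈ σ, u ≠ v → c u ≠ N := fun u hu huv h => huv (hinj hu hv (h.trans hcv.symm))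
    have hb : ε v = b := by
      have := hε v hv
      rw [hcv] at this
      push_cast at this
      rw [← add_assoc, add_assoc (b + (N : ZMod 2)), CharTwo.add_self_eq_zero, add_zero] at this
      exact add_right_cancel this
    rw [alternating_succ_of_unique hv hcv h1, if_pos hb]
    have hcard' := Finset.card_erase_add_one hv
    refine ih (by omega) (fun u hu => ?_) (hinj.mono (by simp)) (fun u hu => ?_)
    · have h := Finset.mem_erase.1 hu
      have := hN u h.2
      have := h1 u h.2 h.1
      omega
    · rw [hε u (Finset.mem_of_mem_erase hu)]
      push_cast
      ring

theorem alternating_image {W : Type*} [DecidableEq W] (φ : W → V) (hφ : Function.Injective φ)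
    (N : ℕ) (b : ZMod 2) (σ : Finset W) :
    alternating c ε N b (σ.image φ) = alternating (c ∘ φ) (ε ∘ φ) N b σ := by
  induction N generalizing b σ with
  | zero => simp [alternating]
  | succ N ih =>
    rw [alternating, alternating, ih, Finset.sum_image (fun _ _ _ _ h => hφ h)]
    congr 1
    refine Finset.sum_congr rfl fun v _ => ?_
    rw [← Finset.image_erase hφ, ih]
    rfl

/-- Only the agreement of signs with the starting sign matters, so flipping all signs together with
`b` changes nothing. This is what trades `b + 1` for the antipodal simplex. -/
theorem alternating_congr {c' : V → ℕ} {ε' : V → ZMod 2} {N : ℕ} {b b' : ZMod 2} {σ : Finset V}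
    (hc : ∀ v ∈ σ, c' v = c v) (hε : ∀ v ∈ σ, (ε' v = b' ↔ ε v = b)) :
    alternating c' ε' N b' σ = alternating c ε N b σ := by
  induction N generalizing b b' σ with
  | zero => simp [alternating]
  | succ N ih =>
    rw [alternating, alternating, ih hc hε]
    congr 1
    refine Finset.sum_congr rfl fun v hv => ?_
    simp only [hc v hv, hε v hv]
    rw [ih (fun u hu => hc u (Finset.mem_of_mem_erase hu)) fun u hu => ?_]
    have := hε u (Finset.mem_of_mem_erase hu)
    rw [zmod_two_eq_add_one_iff, zmod_two_eq_add_one_iff, not_iff_not]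
    exact this

end alternating

/-! ### Kuhn triangulation of boxes and the mod 2 Stokes formula -/

/-- The `j`-th vertex of the Kuhn simplex in the unit cube at `w` along which the coordinates are
increased in the order given by the ranks `ρ`. -/
def kuhnVertex {m : ℕ} (w : Fin m → ℤ) (ρ : Equiv.Perm (Fin m)) (j : ℕ) : Fin m → ℤ :=
  fun i => w i + if (ρ i : ℕ) < j then 1 else 0

/-- The Kuhn simplex of the unit cube at `w` with ranks `ρ`. -/
def kuhnSimplex {m : ℕ} (w : Fin m → ℤ) (ρ : Equiv.Perm (Fin m)) : Finset (Fin m → ℤ) :=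
  (Finset.range (m + 1)).image (kuhnVertex w ρ)

/-- The `j`-th vertex of a Kuhn simplex of a facet of the unit cube at `w`: the coordinate of rank
`0` remains constant. -/
def kuhnFaceVertex {m : ℕ} (w : Fin m → ℤ) (ρ : Equiv.Perm (Fin m)) (j : ℕ) : Fin m → ℤ :=
  fun i => w i + if 0 < (ρ i : ℕ) ∧ (ρ i : ℕ) ≤ j then 1 else 0

/-- The Kuhn simplex, with ranks `ρ`, of the facet at `w` of the unit cube on which the coordinate
of rank `0` is constant. -/
def kuhnFace {m : ℕ} (w : Fin m → ℤ) (ρ : Equiv.Perm (Fin m)) : Finset (Fin m → ℤ) :=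
  (Finset.range m).image (kuhnFaceVertex w ρ)

/-- The lattice points of a half-open box, the range of the coordinate `i` being replaced
by `X`. -/
noncomputable def boxWith {m : ℕ} (lo hi : Fin m → ℤ) (i : Fin m) (X : Finset ℤ) : Finset (Fin m → ℤ) :=
  Fintype.piFinset fun a => if a = i then X else Finset.Ico (lo a) (hi a)

/-- The lattice points of a half-open box. -/
noncomputable def latticeBox {m : ℕ} (lo hi : Fin m → ℤ) : Finset (Fin m → ℤ) :=
  Fintype.piFinset fun a => Finset.Ico (lo a) (hi a)

/-- The sum of a cochain over all Kuhn simplices of a box. -/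
noncomputable def kuhnSum {m : ℕ} (lo hi : Fin m → ℤ) (f : Finset (Fin m → ℤ) → ZMod 2) : ZMod 2 :=
  ∑ ρ : Equiv.Perm (Fin m), ∑ w ∈ latticeBox lo hi, f (kuhnSimplex w ρ)

/-- The sum of a cochain over the Kuhn simplices of the facets of a box that are parallel to the
first coordinate axis. -/
noncomputable def kuhnSideSum {d : ℕ} (lo hi : Fin (d + 1) → ℤ)
    (f : Finset (Fin (d + 1) → ℤ) → ZMod 2) : ZMod 2 :=
  ∑ ρ : Equiv.Perm (Fin (d + 1)) with ρ 0 ≠ 0,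
    (∑ w ∈ boxWith lo hi (ρ.symm 0) {lo (ρ.symm 0)}, f (kuhnFace w ρ) +
      ∑ w ∈ boxWith lo hi (ρ.symm 0) {hi (ρ.symm 0)}, f (kuhnFace w ρ))

theorem mem_boxWith {m : ℕ} {lo hi : Fin m → ℤ} {i : Fin m} {X : Finset ℤ} {w : Fin m → ℤ} :
    w ∈ boxWith lo hi i X ↔ w i ∈ X ∧ ∀ a, a ≠ i → lo a ≤ w a ∧ w a < hi a := by
  simp only [boxWith, Fintype.mem_piFinset]
  constructor
  · intro h
    refine ⟨by simpa using h i, fun a ha => by simpa [ha] using h a⟩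
  · rintro ⟨h1, h2⟩ a
    by_cases ha : a = i
    · subst ha
      simpa using h1
    · simpa [ha] using h2 a ha

theorem mem_latticeBox {m : ℕ} {lo hi : Fin m → ℤ} {w : Fin m → ℤ} :
    w ∈ latticeBox lo hi ↔ ∀ a, lo a ≤ w a ∧ w a < hi a := by
  simp [latticeBox]

theorem latticeBox_eq_boxWith {m : ℕ} (lo hi : Fin m → ℤ) (i : Fin m) :
    latticeBox lo hi = boxWith lo hi i (Finset.Ico (lo i) (hi i)) := by
  ext w
  rw [mem_boxWith, mem_latticeBox, Finset.mem_Ico]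
  constructor
  · exact fun h => ⟨h i, fun a _ => h a⟩
  · rintro ⟨h1, h2⟩ a
    by_cases ha : a = i
    · subst ha
      exact h1
    · exact h2 a ha

theorem sum_boxWith_union {m : ℕ} (lo hi : Fin m → ℤ) (i : Fin m) {X Y : Finset ℤ}
    (h : Disjoint X Y) (g : (Fin m → ℤ) → ZMod 2) :
    ∑ w ∈ boxWith lo hi i (X ∪ Y), g w =
      ∑ w ∈ boxWith lo hi i X, g w + ∑ w ∈ boxWith lo hi i Y, g w := by
  rw [← Finset.sum_union]
  · congr 1
    ext w
    simp only [mem_boxWith, Finset.mem_union]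
    tauto
  · rw [Finset.disjoint_left] at h ⊢
    intro w hX hY
    exact h (mem_boxWith.1 hX).1 (mem_boxWith.1 hY).1

theorem sum_boxWith_shift {m : ℕ} (lo hi : Fin m → ℤ) (i : Fin m) (g : (Fin m → ℤ) → ZMod 2) :
    ∑ w ∈ boxWith lo hi i (Finset.Ico (lo i) (hi i)), g (w + Pi.single i 1) =
      ∑ w ∈ boxWith lo hi i (Finset.Ioc (lo i) (hi i)), g w := by
  refine Finset.sum_bij' (fun w _ => w + Pi.single i 1) (fun w _ => w - Pi.single i 1)
    ?_ ?_ ?_ ?_ ?_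
  · intro w hw
    rw [mem_boxWith, Finset.mem_Ico] at hw
    rw [mem_boxWith, Finset.mem_Ioc]
    refine ⟨by simp only [Pi.add_apply, Pi.single_eq_same]; omega, fun a ha => ?_⟩
    simpa [ha] using hw.2 a ha
  · intro w hw
    rw [mem_boxWith, Finset.mem_Ioc] at hw
    rw [mem_boxWith, Finset.mem_Ico]
    refine ⟨by simp only [Pi.sub_apply, Pi.single_eq_same]; omega, fun a ha => ?_⟩
    simpa [ha] using hw.2 a ha
  · intro w _; simp
  · intro w _; simp
  · intro w _; rfl

theorem sum_latticeBox_telescope {m : ℕ} (lo hi : Fin m → ℤ) (i : Fin m) (h : lo i ≤ hi i)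
    (g : (Fin m → ℤ) → ZMod 2) :
    ∑ w ∈ latticeBox lo hi, (g w + g (w + Pi.single i 1)) =
      ∑ w ∈ boxWith lo hi i {lo i}, g w + ∑ w ∈ boxWith lo hi i {hi i}, g w := by
  rw [Finset.sum_add_distrib, latticeBox_eq_boxWith lo hi i, sum_boxWith_shift]
  have h1 : Finset.Ico (lo i) (hi i) ∪ {hi i} = {lo i} ∪ Finset.Ioc (lo i) (hi i) := by
    ext x
    simp only [Finset.mem_union, Finset.mem_Ico, Finset.mem_singleton, Finset.mem_Ioc]
    omega
  have e := sum_boxWith_union lo hi i (X := Finset.Ico (lo i) (hi i)) (Y := {hi i}) (by simp) g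
  rw [h1, sum_boxWith_union lo hi i (by simp) g] at e
  generalize ∑ w ∈ boxWith lo hi i (Finset.Ico (lo i) (hi i)), g w = a at *
  generalize ∑ w ∈ boxWith lo hi i (Finset.Ioc (lo i) (hi i)), g w = b at *
  generalize ∑ w ∈ boxWith lo hi i {lo i}, g w = c at *
  generalize ∑ w ∈ boxWith lo hi i {hi i}, g w = d at *
  revert a b c d
  decide

theorem kuhnVertex_injOn {m : ℕ} (w : Fin m → ℤ) (ρ : Equiv.Perm (Fin m)) :
    Set.InjOn (kuhnVertex w ρ) (Finset.range (m + 1)) := by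
  have key : ∀ j j' : ℕ, j < j' → j' < m + 1 → kuhnVertex w ρ j ≠ kuhnVertex w ρ j' := by
    intro j j' h h' he
    have := congrFun he (ρ.symm ⟨j, by omega⟩)
    simp [kuhnVertex, h] at this
  intro j hj j' hj' he
  simp only [Finset.coe_range, Set.mem_Iio] at hj hj'
  rcases lt_trichotomy j j' with h | h | h
  · exact absurd he (key _ _ h hj')
  · exact h
  · exact absurd he.symm (key _ _ h hj)

theorem kuhnSimplex_card {m : ℕ} (w : Fin m → ℤ) (ρ : Equiv.Perm (Fin m)) :
    (kuhnSimplex w ρ).card = m + 1 := by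
  rw [kuhnSimplex, Finset.card_image_of_injOn (kuhnVertex_injOn w ρ), Finset.card_range]

theorem coboundary_kuhnSimplex {m : ℕ} (w : Fin m → ℤ) (ρ : Equiv.Perm (Fin m))
    (f : Finset (Fin m → ℤ) → ZMod 2) :
    coboundary f (kuhnSimplex w ρ) =
      ∑ j ∈ Finset.range (m + 1), f (((Finset.range (m + 1)).erase j).image (kuhnVertex w ρ)) := by
  rw [coboundary, kuhnSimplex, Finset.sum_image (kuhnVertex_injOn w ρ)]
  refine Finset.sum_congr rfl fun j hj => congrArg f ?_
  ext v
  simp only [Finset.mem_erase, Finset.mem_image]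
  constructor
  · rintro ⟨h1, j', h2, rfl⟩
    exact ⟨j', ⟨fun h => h1 (by rw [h]), h2⟩, rfl⟩
  · rintro ⟨j', ⟨h1, h2⟩, rfl⟩
    exact ⟨fun h => h1 (kuhnVertex_injOn w ρ h2 hj h), j', h2, rfl⟩

/-- The facets of the Kuhn simplices in the interior of the cube cancel. -/
theorem sum_perm_interior {m : ℕ} {M : Type*} [AddCommMonoid M] (hM : ∀ x : M, x + x = 0)
    {j : ℕ} (h0 : 0 < j) (hj : j < m) (F : Equiv.Perm (Fin m) → M)
    (hF : ∀ ρ, F (Equiv.swap ⟨j - 1, by omega⟩ ⟨j, hj⟩ * ρ) = F ρ) : ∑ ρ, F ρ = 0 := by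
  refine Finset.sum_involution (fun ρ _ => Equiv.swap ⟨j - 1, by omega⟩ ⟨j, hj⟩ * ρ) ?_ ?_ ?_ ?_
  · intro ρ _
    rw [hF]
    exact hM _
  · intro ρ _ _ h
    have h' : Equiv.swap (⟨j - 1, by omega⟩ : Fin m) ⟨j, hj⟩ = 1 := by simpa using h
    rw [Equiv.swap_eq_one_iff] at h'
    have := congrArg Fin.val h'
    simp at this
    omega
  · intro ρ _; exact Finset.mem_univ _
  · intro ρ _; simp

theorem swap_mul_lt_iff {m : ℕ} {j l : ℕ} (h0 : 0 < j) (hj : j < m) (hl : l ≠ j)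
    (ρ : Equiv.Perm (Fin m)) (i : Fin m) :
    ((Equiv.swap (⟨j - 1, by omega⟩ : Fin m) ⟨j, hj⟩ * ρ) i : ℕ) < l ↔ (ρ i : ℕ) < l := by
  rw [Equiv.Perm.mul_apply]
  by_cases h1 : ρ i = ⟨j - 1, by omega⟩
  · rw [h1, Equiv.swap_apply_left]
    simp only
    omega
  by_cases h2 : ρ i = ⟨j, hj⟩
  · rw [h2, Equiv.swap_apply_right]
    simp only
    omega
  rw [Equiv.swap_apply_of_ne_of_ne h1 h2]

theorem image_kuhnVertex_erase_zero {d : ℕ} (w : Fin (d + 1) → ℤ) (ρ : Equiv.Perm (Fin (d + 1))) :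
    ((Finset.range (d + 1 + 1)).erase 0).image (kuhnVertex w ρ) =
      kuhnFace (w + Pi.single (ρ.symm 0) 1) ρ := by
  have : (Finset.range (d + 1 + 1)).erase 0 = (Finset.range (d + 1)).image (· + 1) := by
    ext j
    simp only [Finset.mem_erase, Finset.mem_range, Finset.mem_image]
    constructor
    · exact fun h => ⟨j - 1, by omega, by omega⟩
    · rintro ⟨l, hl, rfl⟩
      omega
  rw [this, Finset.image_image, kuhnFace]
  refine Finset.image_congr fun j _ => ?_
  funext i
  simp only [Function.comp, kuhnVertex, kuhnFaceVertex, Pi.add_apply]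
  by_cases hi : i = ρ.symm 0
  · subst hi
    simp
  · have h0 : ρ i ≠ 0 := fun h => hi (by rw [← h, Equiv.symm_apply_apply])
    have h0' : 0 < (ρ i : ℕ) := Nat.pos_of_ne_zero fun h => h0 (Fin.ext h)
    rw [Pi.single_eq_of_ne hi, add_zero]
    simp only [h0', true_and, Nat.lt_succ_iff]

/-- Without the last vertex, the coordinate of top rank is never increased; rotating the ranks makes
it the coordinate of rank `0`, as `kuhnFace` requires. -/
theorem image_kuhnVertex_erase_last {d : ℕ} (w : Fin (d + 1) → ℤ) (ρ : Equiv.Perm (Fin (d + 1))) :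
    ((Finset.range (d + 1 + 1)).erase (d + 1)).image (kuhnVertex w ρ) =
      kuhnFace w (finRotate (d + 1) * ρ) := by
  have : (Finset.range (d + 1 + 1)).erase (d + 1) = Finset.range (d + 1) := by
    rw [Finset.range_add_one, Finset.erase_insert (by simp)]
  rw [this, kuhnFace]
  refine Finset.image_congr fun j hj => ?_
  funext i
  simp only [Finset.coe_range, Set.mem_Iio] at hj
  have hr : ((finRotate (d + 1) * ρ) i : ℕ) = if ρ i = Fin.last d then 0 else (ρ i : ℕ) + 1 := by
    rw [Equiv.Perm.mul_apply]
    split_ifs with hi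
    · rw [hi, finRotate_last, Fin.val_zero]
    · exact coe_finRotate_of_ne_last hi
  simp only [kuhnVertex, kuhnFaceVertex, hr]
  congr 1
  refine if_congr ?_ rfl rfl
  split_ifs with hi
  · rw [hi, Fin.val_last]
    omega
  · omega

/-- Stokes' formula. Facets inside a unit cube cancel in pairs, and facets on the common wall of
adjacent unit cubes telescope, so only the walls of the box survive. -/
theorem kuhnSum_coboundary {d : ℕ} (lo hi : Fin (d + 1) → ℤ) (h : ∀ i, lo i ≤ hi i)
    (f : Finset (Fin (d + 1) → ℤ) → ZMod 2) :
    kuhnSum lo hi (coboundary f) = ∑ ρ : Equiv.Perm (Fin (d + 1)),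
      (∑ w ∈ boxWith lo hi (ρ.symm 0) {lo (ρ.symm 0)}, f (kuhnFace w ρ) +
        ∑ w ∈ boxWith lo hi (ρ.symm 0) {hi (ρ.symm 0)}, f (kuhnFace w ρ)) := by
  have h1 : ∀ w : Fin (d + 1) → ℤ, ∑ ρ : Equiv.Perm (Fin (d + 1)), coboundary f (kuhnSimplex w ρ) =
      ∑ ρ : Equiv.Perm (Fin (d + 1)),
        (f (kuhnFace w ρ) + f (kuhnFace (w + Pi.single (ρ.symm 0) 1) ρ)) := by
    intro w
    simp only [coboundary_kuhnSimplex]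
    rw [Finset.sum_comm, Finset.sum_range_succ, Finset.sum_range_succ']
    simp only [image_kuhnVertex_erase_zero, image_kuhnVertex_erase_last]
    rw [Finset.sum_eq_zero, zero_add, add_comm, Finset.sum_add_distrib]
    · congr 1
      exact Equiv.sum_comp (Equiv.mulLeft (finRotate (d + 1))) fun ρ => f (kuhnFace w ρ)
    · intro j hj
      rw [Finset.mem_range] at hj
      refine sum_perm_interior CharTwo.add_self_eq_zero (j := j + 1) (by omega) (by omega) _ ?_
      intro ρ
      refine congrArg f (Finset.image_congr fun l hl => ?_)
      funext i
      have hl' : l ≠ j + 1 := (Finset.mem_erase.1 (Finset.mem_coe.1 hl)).1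
      simp only [kuhnVertex]
      rw [if_congr (swap_mul_lt_iff (by omega) (by omega) hl' ρ i) rfl rfl]
  rw [kuhnSum, Finset.sum_comm, Finset.sum_congr rfl fun w _ => h1 w, Finset.sum_comm]
  exact Finset.sum_congr rfl fun ρ _ =>
    sum_latticeBox_telescope lo hi (ρ.symm 0) (h _) fun w => f (kuhnFace w ρ)

theorem kuhnVertex_neg {m : ℕ} (w : Fin m → ℤ) (ρ : Equiv.Perm (Fin m)) {j : ℕ} (hj : j ≤ m) :
    -kuhnVertex w ρ j = kuhnVertex (-w - 1) (Fin.revPerm * ρ) (m - j) := by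
  funext i
  simp only [Pi.neg_apply, kuhnVertex, Pi.sub_apply, Pi.one_apply, Equiv.Perm.mul_apply,
    Fin.revPerm_apply, Fin.val_rev]
  have := (ρ i).isLt
  split_ifs <;> omega

theorem kuhnSimplex_neg {m : ℕ} (w : Fin m → ℤ) (ρ : Equiv.Perm (Fin m)) :
    (kuhnSimplex w ρ).image (fun v => -v) = kuhnSimplex (-w - 1) (Fin.revPerm * ρ) := by
  rw [kuhnSimplex, kuhnSimplex, Finset.image_image]
  ext v
  simp only [Finset.mem_image, Finset.mem_range, Function.comp]
  constructor
  · rintro ⟨j, hj, rfl⟩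
    exact ⟨m - j, by omega, (kuhnVertex_neg w ρ (by omega)).symm⟩
  · rintro ⟨j, hj, rfl⟩
    refine ⟨m - j, by omega, ?_⟩
    rw [kuhnVertex_neg w ρ (by omega), Nat.sub_sub_self (by omega)]

theorem kuhnSum_neg {m : ℕ} (lo hi : Fin m → ℤ) (f : Finset (Fin m → ℤ) → ZMod 2) :
    kuhnSum lo hi (fun σ => f (σ.image fun v => -v)) = kuhnSum (-hi) (-lo) f := by
  unfold kuhnSum
  simp only [kuhnSimplex_neg]
  rw [← Equiv.sum_comp (Equiv.mulLeft Fin.revPerm)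
    fun ρ => ∑ w ∈ latticeBox (-hi) (-lo), f (kuhnSimplex w ρ)]
  refine Finset.sum_congr rfl fun ρ _ => ?_
  refine Finset.sum_bij' (fun w _ => -w - 1) (fun w _ => -w - 1) ?_ ?_ ?_ ?_ ?_
  · intro w hw
    rw [mem_latticeBox] at hw ⊢
    intro a
    have := hw a
    simp only [Pi.neg_apply, Pi.sub_apply, Pi.one_apply]
    omega
  · intro w hw
    rw [mem_latticeBox] at hw ⊢
    intro a
    have := hw a
    simp only [Pi.neg_apply, Pi.sub_apply, Pi.one_apply] at this ⊢
    omega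
  · intro w _; simp
  · intro w _; simp
  · intro w _; rfl

theorem kuhnSum_add {m : ℕ} (lo hi : Fin m → ℤ) (f g : Finset (Fin m → ℤ) → ZMod 2) :
    kuhnSum lo hi (fun σ => f σ + g σ) = kuhnSum lo hi f + kuhnSum lo hi g := by
  simp only [kuhnSum, Finset.sum_add_distrib]

theorem cons_injective {d : ℕ} (t : ℤ) :
    Function.Injective fun v : Fin d → ℤ => (Fin.cons t v : Fin (d + 1) → ℤ) :=
  Fin.cons_right_injective (α := fun _ => ℤ) t

theorem kuhnFace_cons {d : ℕ} (t : ℤ) (w : Fin d → ℤ) (e : Equiv.Perm (Fin d)) :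
    kuhnFace (Fin.cons t w : Fin (d + 1) → ℤ) (Equiv.Perm.decomposeFin.symm (0, e)) =
      (kuhnSimplex w e).image fun v => (Fin.cons t v : Fin (d + 1) → ℤ) := by
  rw [kuhnFace, kuhnSimplex, Finset.image_image]
  refine Finset.image_congr fun j _ => ?_
  funext i
  simp only [kuhnFaceVertex, Function.comp]
  refine Fin.cases ?_ (fun a => ?_) i
  · rw [Equiv.Perm.decomposeFin_symm_apply_zero, Fin.cons_zero, Fin.cons_zero, if_neg (by simp),
      add_zero]
  · rw [Equiv.Perm.decomposeFin_symm_apply_succ, Fin.cons_succ, Fin.cons_succ, Equiv.swap_self,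
      Equiv.refl_apply, kuhnVertex]
    refine congrArg _ (if_congr ?_ rfl rfl)
    rw [Fin.val_succ]
    omega

theorem sum_boxWith_zero {d : ℕ} (lo hi : Fin (d + 1) → ℤ) (t : ℤ)
    (g : (Fin (d + 1) → ℤ) → ZMod 2) :
    ∑ w ∈ boxWith lo hi 0 {t}, g w =
      ∑ w ∈ latticeBox (fun a => lo a.succ) (fun a => hi a.succ), g (Fin.cons t w) := by
  refine Finset.sum_bij' (fun w _ => fun a => w a.succ) (fun w _ => Fin.cons t w) ?_ ?_ ?_ ?_ ?_
  · intro w hw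
    rw [mem_boxWith] at hw
    exact mem_latticeBox.2 fun a => hw.2 a.succ (Fin.succ_ne_zero a)
  · intro w hw
    rw [mem_latticeBox] at hw
    refine mem_boxWith.2 ⟨by simp, fun a => ?_⟩
    refine Fin.cases (fun h => absurd rfl h) (fun a _ => ?_) a
    simpa using hw a
  · intro w hw
    have h0 : w 0 = t := by simpa using (mem_boxWith.1 hw).1
    rw [← h0]
    exact Fin.cons_self_tail w
  · intro w _
    rfl
  · intro w hw
    have h0 : w 0 = t := by simpa using (mem_boxWith.1 hw).1
    rw [← h0]
    exact congrArg g (Fin.cons_self_tail w).symm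

theorem kuhnSum_coboundary_eq_cap_add_sides {d : ℕ} (lo hi : Fin (d + 1) → ℤ)
    (h : ∀ i, lo i ≤ hi i) (f : Finset (Fin (d + 1) → ℤ) → ZMod 2) :
    kuhnSum lo hi (coboundary f) =
      kuhnSum (fun a => lo a.succ) (fun a => hi a.succ)
        (fun σ => f (σ.image fun v => (Fin.cons (lo 0) v : Fin (d + 1) → ℤ))) +
      kuhnSum (fun a => lo a.succ) (fun a => hi a.succ)
        (fun σ => f (σ.image fun v => (Fin.cons (hi 0) v : Fin (d + 1) → ℤ))) +
      kuhnSideSum lo hi f := by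
  rw [kuhnSideSum, kuhnSum_coboundary lo hi h, ← Finset.sum_filter_add_sum_filter_not _ fun ρ => ρ 0 = 0]
  congr 1
  unfold kuhnSum
  rw [← Finset.sum_add_distrib]
  refine Finset.sum_bij' (fun ρ _ => (Equiv.Perm.decomposeFin ρ).2)
    (fun e _ => Equiv.Perm.decomposeFin.symm (0, e)) ?_ ?_ ?_ ?_ ?_
  · intro ρ _; exact Finset.mem_univ _
  · intro e _; simp
  · intro ρ hρ
    have h0 : ρ 0 = 0 := by simpa using hρ
    have h1 : (Equiv.Perm.decomposeFin ρ).1 = 0 := by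
      have := Equiv.Perm.decomposeFin_symm_apply_zero (Equiv.Perm.decomposeFin ρ).1
        (Equiv.Perm.decomposeFin ρ).2
      rw [Prod.mk.eta, Equiv.symm_apply_apply, h0] at this
      exact this.symm
    rw [← h1, Prod.mk.eta, Equiv.symm_apply_apply]
  · intro e _; simp
  · intro ρ hρ
    have h0 : ρ 0 = 0 := by simpa using hρ
    have h1 : (Equiv.Perm.decomposeFin ρ).1 = 0 := by
      have := Equiv.Perm.decomposeFin_symm_apply_zero (Equiv.Perm.decomposeFin ρ).1
        (Equiv.Perm.decomposeFin ρ).2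
      rw [Prod.mk.eta, Equiv.symm_apply_apply, h0] at this
      exact this.symm
    have h2 : ρ.symm 0 = 0 := by rw [Equiv.symm_apply_eq, h0]
    have h3 : ρ = Equiv.Perm.decomposeFin.symm (0, (Equiv.Perm.decomposeFin ρ).2) := by
      rw [← h1, Prod.mk.eta, Equiv.symm_apply_apply]
    rw [h2, sum_boxWith_zero, sum_boxWith_zero]
    generalize (Equiv.Perm.decomposeFin ρ).2 = e at h3
    subst h3
    simp only [kuhnFace_cons]

/-! ### Fan's theorem on the boundary of a cube -/

/-- A nonempty set of lattice points, pairwise joined by edges of the Kuhn triangulation, in a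
facet of the cube `[-R, R]^m`. -/
def IsBoundaryCell {m : ℕ} (R : ℤ) (σ : Finset (Fin m → ℤ)) : Prop :=
  σ.Nonempty ∧ (∃ i a, |a| = R ∧ ∀ v ∈ σ, v i = a) ∧
    ∀ u ∈ σ, ∀ v ∈ σ, (u ≤ v ∧ v ≤ u + 1) ∨ (v ≤ u ∧ u ≤ v + 1)

theorem kuhnVertex_mono {m : ℕ} (w : Fin m → ℤ) (ρ : Equiv.Perm (Fin m)) {j l : ℕ} (h : j ≤ l) :
    kuhnVertex w ρ j ≤ kuhnVertex w ρ l ∧ kuhnVertex w ρ l ≤ kuhnVertex w ρ j + 1 := by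
  constructor <;> intro i <;> simp only [kuhnVertex, Pi.add_apply, Pi.one_apply] <;>
    split_ifs <;> omega

theorem kuhnFaceVertex_mono {m : ℕ} (w : Fin m → ℤ) (ρ : Equiv.Perm (Fin m)) {j l : ℕ}
    (h : j ≤ l) : kuhnFaceVertex w ρ j ≤ kuhnFaceVertex w ρ l ∧
      kuhnFaceVertex w ρ l ≤ kuhnFaceVertex w ρ j + 1 := by
  constructor <;> intro i <;> simp only [kuhnFaceVertex, Pi.add_apply, Pi.one_apply] <;>
    split_ifs <;> omega

theorem isBoundaryCell_cap {d : ℕ} {R : ℤ} (hR : 0 ≤ R) (w : Fin d → ℤ) (e : Equiv.Perm (Fin d)) :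
    IsBoundaryCell R ((kuhnSimplex w e).image fun v => (Fin.cons R v : Fin (d + 1) → ℤ)) := by
  refine ⟨by simp [kuhnSimplex], ⟨0, R, abs_of_nonneg hR, ?_⟩, ?_⟩
  · intro v hv
    obtain ⟨v, _, rfl⟩ := Finset.mem_image.1 hv
    rfl
  · have key : ∀ u v : Fin d → ℤ, u ≤ v ∧ v ≤ u + 1 →
        (Fin.cons R u : Fin (d + 1) → ℤ) ≤ Fin.cons R v ∧
          (Fin.cons R v : Fin (d + 1) → ℤ) ≤ Fin.cons R u + 1 := by
      rintro u v ⟨h1, h2⟩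
      refine ⟨Fin.cons_le_cons.2 ⟨le_rfl, h1⟩, fun i => ?_⟩
      refine Fin.cases ?_ (fun a => ?_) i
      · simp
      · simpa using h2 a
    intro u hu v hv
    obtain ⟨u, hu', rfl⟩ := Finset.mem_image.1 hu
    obtain ⟨v, hv', rfl⟩ := Finset.mem_image.1 hv
    obtain ⟨j, _, rfl⟩ := Finset.mem_image.1 hu'
    obtain ⟨l, _, rfl⟩ := Finset.mem_image.1 hv'
    rcases le_total j l with h | h
    · exact Or.inl (key _ _ (kuhnVertex_mono w e h))
    · exact Or.inr (key _ _ (kuhnVertex_mono w e h))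

theorem kuhnFaceVertex_symm_zero {d : ℕ} (w : Fin (d + 1) → ℤ) (ρ : Equiv.Perm (Fin (d + 1)))
    (j : ℕ) : kuhnFaceVertex w ρ j (ρ.symm 0) = w (ρ.symm 0) := by
  simp [kuhnFaceVertex]

theorem isBoundaryCell_kuhnFace {d : ℕ} {R : ℤ} (w : Fin (d + 1) → ℤ)
    (ρ : Equiv.Perm (Fin (d + 1))) (h : |w (ρ.symm 0)| = R) : IsBoundaryCell R (kuhnFace w ρ) := by
  refine ⟨by simp [kuhnFace], ⟨ρ.symm 0, _, h, ?_⟩, ?_⟩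
  · intro v hv
    obtain ⟨j, _, rfl⟩ := Finset.mem_image.1 hv
    exact kuhnFaceVertex_symm_zero w ρ j
  · intro u hu v hv
    obtain ⟨j, _, rfl⟩ := Finset.mem_image.1 hu
    obtain ⟨l, _, rfl⟩ := Finset.mem_image.1 hv
    rcases le_total j l with h | h
    · exact Or.inl (kuhnFaceVertex_mono w ρ h)
    · exact Or.inr (kuhnFaceVertex_mono w ρ h)

/-- A labelling of the lattice points by colors smaller than `N` and mod 2 signs, which is
antisymmetric and has no complementary edges on the boundary of the cube `[-R, R]^m`. -/
structure IsFanLabelling {m : ℕ} (R : ℤ) (N : ℕ) (c : (Fin m → ℤ) → ℕ)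
    (ε : (Fin m → ℤ) → ZMod 2) : Prop where
  color_lt : ∀ v, c v < N
  color_neg : ∀ v, c (-v) = c v
  sign_neg : ∀ v, v ≠ 0 → ε (-v) = ε v + 1
  sign_eq : ∀ u v, u ≤ v → v ≤ u + 1 → (∃ i, u i = v i ∧ |u i| = R) → c u = c v → ε u = ε v

theorem IsFanLabelling.cons {d : ℕ} {R : ℤ} {N : ℕ} {c : (Fin (d + 1) → ℤ) → ℕ}
    {ε : (Fin (d + 1) → ℤ) → ZMod 2} (h : IsFanLabelling R N c ε) :
    IsFanLabelling R N (c ∘ fun v : Fin d → ℤ => (Fin.cons 0 v : Fin (d + 1) → ℤ))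
      (ε ∘ fun v : Fin d → ℤ => (Fin.cons 0 v : Fin (d + 1) → ℤ)) := by
  have hneg : ∀ v : Fin d → ℤ, (Fin.cons 0 (-v) : Fin (d + 1) → ℤ) = -Fin.cons 0 v := by
    intro v
    funext i
    refine Fin.cases ?_ (fun a => ?_) i <;> simp
  refine ⟨fun v => h.color_lt _, fun v => ?_, fun v hv => ?_, fun u v h1 h2 h3 => ?_⟩
  · simp only [Function.comp, hneg, h.color_neg]
  · simp only [Function.comp, hneg]
    refine h.sign_neg _ fun h0 => hv ?_
    funext a
    simpa using congrFun h0 a.succ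
  · refine h.sign_eq _ _ (Fin.cons_le_cons.2 ⟨le_rfl, h1⟩) (fun i => ?_) ?_
    · refine Fin.cases ?_ (fun a => ?_) i
      · simp
      · simpa using h2 a
    · obtain ⟨i, hi⟩ := h3
      exact ⟨i.succ, by simpa using hi⟩

/-- On the boundary Fan's formula applies, and passing to the antipodes flips every sign, which
turns the term with starting sign `b + 1` into the value at `-σ`. -/
theorem IsFanLabelling.coboundary_alternating {m : ℕ} {R : ℤ} (hR : 0 < R) {N : ℕ}
    {c : (Fin m → ℤ) → ℕ} {ε : (Fin m → ℤ) → ZMod 2} (h : IsFanLabelling R N c ε) (b : ZMod 2)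
    {σ : Finset (Fin m → ℤ)} (hσ : IsBoundaryCell R σ) :
    coboundary (alternating c ε N b) σ =
      alternating c ε N b σ + alternating c ε N b (σ.image fun v => -v) := by
  obtain ⟨hne, ⟨i, a, ha, hi⟩, hpair⟩ := hσ
  rw [_root_.coboundary_alternating hne fun v _ => h.color_lt v]
  · rw [alternating_image _ neg_injective]
    congr 1
    symm
    refine alternating_congr (fun v _ => h.color_neg v) fun v hv => ?_
    have hv0 : v ≠ 0 := by
      rintro rfl
      have := hi 0 hv
      rw [Pi.zero_apply] at this
      rw [← this, abs_zero] at ha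
      omega
    simp only [Function.comp, h.sign_neg v hv0]
    exact ⟨fun h => by rw [← h, zmod_two_add_one_add_one],
      fun h => by rw [h, zmod_two_add_one_add_one]⟩
  · intro u hu v hv huv
    have hiuv : u i = v i ∧ |u i| = R := ⟨(hi u hu).trans (hi v hv).symm, by rw [hi u hu, ha]⟩
    rcases hpair u hu v hv with h1 | h1
    · exact h.sign_eq u v h1.1 h1.2 ⟨i, hiuv⟩ huv
    · exact (h.sign_eq v u h1.1 h1.2 ⟨i, hiuv.1.symm, by rw [← hiuv.1, hiuv.2]⟩ huv.symm).symm

/-- The lower corner of the upper half of the cube `[-R, R]^(d+1)`. -/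
def halfCorner (d : ℕ) (R : ℤ) : Fin (d + 1) → ℤ := Fin.cons 0 fun _ => -R

theorem kuhnSum_halves {d : ℕ} {R : ℤ} (hR : 0 ≤ R) (f : Finset (Fin (d + 1) → ℤ) → ZMod 2) :
    kuhnSum (fun _ => -R) (fun _ => R) f = kuhnSum (halfCorner d R) (fun _ => R) f +
      kuhnSum (fun _ => -R) (-halfCorner d R) f := by
  unfold kuhnSum
  rw [← Finset.sum_add_distrib]
  refine Finset.sum_congr rfl fun ρ _ => ?_
  rw [latticeBox_eq_boxWith _ _ 0, latticeBox_eq_boxWith (halfCorner d R) _ 0,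
    latticeBox_eq_boxWith _ (-halfCorner d R) 0]
  have h1 : Finset.Ico (-R) R = Finset.Ico 0 R ∪ Finset.Ico (-R) 0 := by
    ext x
    simp only [Finset.mem_union, Finset.mem_Ico]
    omega
  have h2 : Disjoint (Finset.Ico 0 R) (Finset.Ico (-R) 0) := by
    rw [Finset.disjoint_left]
    intro x
    simp only [Finset.mem_Ico]
    omega
  rw [h1, sum_boxWith_union _ _ _ h2]
  have e : ∀ (X : Finset ℤ) (lo hi lo' hi' : Fin (d + 1) → ℤ),
      (∀ a : Fin d, lo a.succ = lo' a.succ ∧ hi a.succ = hi' a.succ) →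
      boxWith lo hi 0 X = boxWith lo' hi' 0 X := by
    intro X lo hi lo' hi' h
    ext w
    rw [mem_boxWith, mem_boxWith]
    refine and_congr_right fun _ => forall_congr' fun a => ?_
    refine Fin.cases ?_ (fun a => ?_) a
    · simp
    · rw [(h a).1, (h a).2]
  congr 1
  · rw [e _ (fun _ => -R) (fun _ => R) (halfCorner d R) (fun _ => R)]
    · rfl
    · intro a; simp [halfCorner]
  · rw [e _ (fun _ => -R) (fun _ => R) (fun _ => -R) (-halfCorner d R)]
    · simp [halfCorner]
    · intro a; simp [halfCorner]

theorem kuhnSum_half_coboundary {d : ℕ} {R : ℤ} (hR : 0 ≤ R)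
    (f : Finset (Fin (d + 1) → ℤ) → ZMod 2) :
    kuhnSum (halfCorner d R) (fun _ => R) (coboundary f) =
      kuhnSum (fun _ : Fin d => -R) (fun _ => R)
        (fun σ => f (σ.image fun v => (Fin.cons 0 v : Fin (d + 1) → ℤ))) +
      (kuhnSum (fun _ : Fin d => -R) (fun _ => R)
        (fun σ => f (σ.image fun v => (Fin.cons R v : Fin (d + 1) → ℤ))) +
      kuhnSideSum (halfCorner d R) (fun _ => R) f) := by
  rw [kuhnSum_coboundary_eq_cap_add_sides, ← add_assoc]
  · rfl
  · intro i
    refine Fin.cases ?_ (fun a => ?_) i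
    · simpa [halfCorner] using hR
    · simp [halfCorner]
      omega

theorem kuhnSideSum_congr {d : ℕ} {R : ℤ} {f g : Finset (Fin (d + 1) → ℤ) → ZMod 2}
    (h : ∀ w ρ, ρ 0 ≠ 0 → |w (ρ.symm 0)| = R → 0 ≤ w 0 → w 0 < R →
      f (kuhnFace w ρ) = g (kuhnFace w ρ)) (hR : 0 ≤ R) :
    kuhnSideSum (halfCorner d R) (fun _ => R) f = kuhnSideSum (halfCorner d R) (fun _ => R) g := by
  refine Finset.sum_congr rfl fun ρ hρ => ?_
  have h0 : ρ 0 ≠ 0 := (Finset.mem_filter.1 hρ).2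
  have h1 : ρ.symm 0 ≠ 0 := fun h => h0 (by rw [← h, Equiv.apply_symm_apply, h])
  obtain ⟨a, ha⟩ := Fin.exists_succ_eq.2 h1
  congr 1 <;>
  · refine Finset.sum_congr rfl fun w hw => ?_
    rw [mem_boxWith, Finset.mem_singleton] at hw
    have h2 := hw.2 0 h1.symm
    refine h w ρ h0 ?_ (by simpa [halfCorner] using h2.1) h2.2
    rw [hw.1]
    try rw [← ha]
    simp [halfCorner, abs_of_nonneg hR]

/-- Stokes' formula on the upper half cube for the cochain `coboundary (alternating c ε N b)`, whose
coboundary vanishes: the equatorial disc and the hemisphere contribute equally, and the disc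
contributes `1` by `ih`. -/
theorem IsFanLabelling.hemisphere {d : ℕ} {R : ℤ} (hR : 0 < R) {N : ℕ}
    {c : (Fin (d + 1) → ℤ) → ℕ} {ε : (Fin (d + 1) → ℤ) → ZMod 2} (h : IsFanLabelling R N c ε)
    (b : ZMod 2)
    (ih : kuhnSum (fun _ : Fin d => -R) (fun _ => R) (coboundary
      (alternating (c ∘ fun v : Fin d → ℤ => (Fin.cons 0 v : Fin (d + 1) → ℤ))
        (ε ∘ fun v : Fin d → ℤ => (Fin.cons 0 v : Fin (d + 1) → ℤ)) N b)) = 1)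
    {f : Finset (Fin (d + 1) → ℤ) → ZMod 2}
    (hf : ∀ σ, f σ = alternating c ε N b σ + alternating c ε N b (σ.image fun v => -v)) :
    kuhnSum (fun _ : Fin d => -R) (fun _ => R)
      (fun σ => f (σ.image fun v => (Fin.cons R v : Fin (d + 1) → ℤ))) +
      kuhnSideSum (halfCorner d R) (fun _ => R) f = 1 := by
  have key := kuhnSum_half_coboundary hR.le (coboundary (alternating c ε N b))
  have hz : kuhnSum (halfCorner d R) (fun _ => R)
      (coboundary (coboundary (alternating c ε N b))) = 0 := by
    simp only [kuhnSum, coboundary_coboundary, Finset.sum_const_zero]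
  have hcap : kuhnSum (fun _ : Fin d => -R) (fun _ => R)
      (fun σ => f (σ.image fun v => (Fin.cons R v : Fin (d + 1) → ℤ))) =
      kuhnSum (fun _ : Fin d => -R) (fun _ => R) (fun σ => coboundary (alternating c ε N b)
        (σ.image fun v => (Fin.cons R v : Fin (d + 1) → ℤ))) := by
    refine Finset.sum_congr rfl fun ρ _ => Finset.sum_congr rfl fun w _ => ?_
    beta_reduce
    rw [h.coboundary_alternating hR b (isBoundaryCell_cap hR.le w ρ), hf]
  have hside : kuhnSideSum (halfCorner d R) (fun _ => R) f =
      kuhnSideSum (halfCorner d R) (fun _ => R) (coboundary (alternating c ε N b)) := by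
    refine kuhnSideSum_congr (fun w ρ _ hw _ _ => ?_) hR.le
    rw [h.coboundary_alternating hR b (isBoundaryCell_kuhnFace w ρ hw), hf]
  have hbase : kuhnSum (fun _ : Fin d => -R) (fun _ => R) (fun σ =>
      coboundary (alternating c ε N b)
        (σ.image fun v => (Fin.cons 0 v : Fin (d + 1) → ℤ))) = 1 := by
    rw [← ih]
    refine Finset.sum_congr rfl fun ρ _ => Finset.sum_congr rfl fun w _ => ?_
    beta_reduce
    rw [← coboundary_image _ _ (cons_injective 0)]
    simp only [alternating_image _ (cons_injective 0)]
  rw [hz, hbase, ← hcap, ← hside] at key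
  exact (CharTwo.add_eq_zero.1 key.symm).symm

/-- Induction on the dimension. By antipodal symmetry the sum over the cube equals the sum of
`coboundary β` over its upper half. Stokes' formula splits this into the disc, where the antipodal
values of `β` cancel, and the hemisphere, which contributes `1`. -/
theorem kuhnSum_coboundary_alternating {d : ℕ} {R : ℤ} (hR : 0 < R) {N : ℕ}
    {c : (Fin d → ℤ) → ℕ} {ε : (Fin d → ℤ) → ZMod 2} (h : IsFanLabelling R N c ε) (b : ZMod 2) :
    kuhnSum (fun _ => -R) (fun _ => R) (coboundary (alternating c ε N b)) = 1 := by
  induction d with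
  | zero =>
    simp [kuhnSum, kuhnSimplex, latticeBox, coboundary, alternating_empty]
  | succ d ih =>
    set α := alternating c ε N b with hα
    set β : Finset (Fin (d + 1) → ℤ) → ZMod 2 := fun σ => α σ + α (σ.image fun v => -v) with hβ
    have h1 := h.hemisphere hR b (ih h.cons) (f := β) fun σ => rfl
    have h2 := kuhnSum_half_coboundary hR.le β
    have h3 : kuhnSum (fun _ : Fin d => -R) (fun _ => R)
        (fun σ => β (σ.image fun v => (Fin.cons 0 v : Fin (d + 1) → ℤ))) = 0 := by
      have e : ∀ σ : Finset (Fin d → ℤ),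
          (σ.image fun v => (Fin.cons 0 v : Fin (d + 1) → ℤ)).image (fun v => -v) =
          (σ.image fun v => -v).image fun v => (Fin.cons 0 v : Fin (d + 1) → ℤ) := by
        intro σ
        rw [Finset.image_image, Finset.image_image]
        refine Finset.image_congr fun v _ => ?_
        funext i
        refine Fin.cases ?_ (fun a => ?_) i <;> simp
      simp only [hβ, e]
      rw [kuhnSum_add, kuhnSum_neg _ _ fun σ => α (σ.image fun v => (Fin.cons 0 v : Fin (d + 1) → ℤ))]
      have e1 : (-fun _ : Fin d => R) = fun _ => -R := rfl
      have e2 : (-fun _ : Fin d => -R) = fun _ => R := by funext; simp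
      rw [e1, e2]
      exact CharTwo.add_self_eq_zero _
    rw [h3, zero_add, h1] at h2
    rw [kuhnSum_halves hR.le, ← h2]
    have h4 : coboundary β = fun σ => coboundary α σ + coboundary α (σ.image fun v => -v) := by
      funext σ
      rw [hβ, coboundary_add, coboundary_image _ _ neg_injective]
    rw [h4, kuhnSum_add, kuhnSum_neg _ _ (coboundary α)]
    rfl

/-! ### Rainbow simplices modulo 2 -/

open Classical in
/-- The mod 2 indicator of the injectivity of a coloring on a finite set. -/
noncomputable def rainbow {ι X : Type*} (u : ι → X) (J : Finset ι) : ZMod 2 :=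
  if Set.InjOn u J then 1 else 0

theorem rainbow_eq_zero {ι X : Type*} {u : ι → X} {J : Finset ι} (h : ¬ Set.InjOn u J) :
    rainbow u J = 0 := if_neg h

theorem rainbow_eq_of_iff {ι κ X Y : Type*} {u : ι → X} {J : Finset ι} {v : κ → Y} {K : Finset κ}
    (h : Set.InjOn u J ↔ Set.InjOn v K) : rainbow u J = rainbow v K := by
  unfold rainbow
  split_ifs <;> tauto

theorem rainbow_congr {ι X : Type*} {u v : ι → X} {J : Finset ι} (h : ∀ j ∈ J, u j = v j) :
    rainbow u J = rainbow v J :=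
  rainbow_eq_of_iff (Set.EqOn.injOn_iff h)

theorem not_injOn_of_missing {ι : Type*} {N : ℕ} {u : ι → Fin N} {J : Finset ι} (hJ : N ≤ J.card)
    (a : Fin N) (ha : ∀ j ∈ J, u j ≠ a) : ¬ Set.InjOn u J := by
  classical
  intro h
  have h1 : J.image u ⊆ Finset.univ.erase a := by
    intro x hx
    obtain ⟨j, hj, rfl⟩ := Finset.mem_image.1 hx
    exact Finset.mem_erase.2 ⟨ha j hj, Finset.mem_univ _⟩
  have h2 := Finset.card_le_card h1
  rw [Finset.card_image_of_injOn h, Finset.card_erase_of_mem (Finset.mem_univ _), Finset.card_univ,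
    Fintype.card_fin] at h2
  have := a.pos
  omega

/-- Two of the `N + 1` points share a color. A rainbow facet must omit one of these two, and
omitting either has the same effect. -/
theorem sum_rainbow_erase {ι : Type*} [DecidableEq ι] {N : ℕ} (u : ι → Fin N) (J : Finset ι)
    (hJ : J.card = N + 1) : ∑ j ∈ J, rainbow u (J.erase j) = 0 := by
  obtain ⟨a, ha, b, hb, hab, hu⟩ := Finset.exists_ne_map_eq_of_card_lt_of_maps_to
    (s := J) (t := Finset.univ) (f := u) (by simp [hJ]) (by simp)
  have key : ∀ a ∈ J, ∀ b ∈ J, a ≠ b → u a = u b → Set.InjOn u (J.erase a) →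
      Set.InjOn u (J.erase b) := by
    intro a ha b hb hab hu h
    have hb' : b ∈ J.erase a := Finset.mem_erase.2 ⟨hab.symm, hb⟩
    have hax : ∀ x ∈ J.erase b, u x = u a → x = a := by
      intro x hx hxa
      by_contra hne
      exact (Finset.mem_erase.1 hx).1 (h (Finset.mem_coe.2 (Finset.mem_erase.2
        ⟨hne, Finset.mem_of_mem_erase hx⟩)) hb' (hxa.trans hu))
    intro x hx y hy hxy
    by_cases hxa : x = a
    · rw [hxa] at hxy ⊢
      exact (hax y hy hxy.symm).symm
    by_cases hya : y = a
    · rw [hya] at hxy ⊢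
      exact hax x hx hxy
    exact h (Finset.mem_coe.2 (Finset.mem_erase.2 ⟨hxa, Finset.mem_of_mem_erase hx⟩))
      (Finset.mem_coe.2 (Finset.mem_erase.2 ⟨hya, Finset.mem_of_mem_erase hy⟩)) hxy
  have hb' : b ∈ J.erase a := Finset.mem_erase.2 ⟨hab.symm, hb⟩
  rw [← Finset.add_sum_erase _ _ ha, ← Finset.add_sum_erase _ _ hb', Finset.sum_eq_zero, add_zero]
  · rw [rainbow_eq_of_iff ⟨key a ha b hb hab hu, key b hb a ha hab.symm hu.symm⟩]
    exact CharTwo.add_self_eq_zero _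
  · intro x hx
    obtain ⟨hxb, hx⟩ := Finset.mem_erase.1 hx
    obtain ⟨hxa, hx⟩ := Finset.mem_erase.1 hx
    refine rainbow_eq_zero fun h => hab (h ?_ ?_ hu)
    · exact Finset.mem_coe.2 (Finset.mem_erase.2 ⟨Ne.symm hxa, ha⟩)
    · exact Finset.mem_coe.2 (Finset.mem_erase.2 ⟨Ne.symm hxb, hb⟩)

theorem rainbow_range_erase {X : Type*} (u : ℕ → X) {n j : ℕ} (hj : j ≤ n) :
    rainbow u ((Finset.range (n + 1)).erase j) =
      rainbow (fun l => u (if l < j then l else l + 1)) (Finset.range n) := by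
  have hinj : Function.Injective fun l : ℕ => if l < j then l else l + 1 := by
    intro a b h
    simp only at h
    split_ifs at h <;> omega
  have : (Finset.range (n + 1)).erase j =
      (Finset.range n).image fun l => if l < j then l else l + 1 := by
    ext x
    simp only [Finset.mem_erase, Finset.mem_range, Finset.mem_image]
    constructor
    · rintro ⟨h1, h2⟩
      by_cases hx : x < j
      · exact ⟨x, by omega, if_pos hx⟩
      · exact ⟨x - 1, by omega, by rw [if_neg (by omega)]; omega⟩
    · rintro ⟨l, hl, rfl⟩
      split_ifs <;> omega
  rw [this]
  apply rainbow_eq_of_iff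
  rw [Finset.coe_image]
  constructor
  · intro h a ha b hb hab
    exact hinj (h ⟨a, ha, rfl⟩ ⟨b, hb, rfl⟩ hab)
  · rintro h _ ⟨a, ha, rfl⟩ _ ⟨b, hb, rfl⟩ hab
    exact congrArg (fun l : ℕ => if l < j then l else l + 1) (h ha hb hab)

/-! ### Parity of rainbow Kuhn simplices in a unit cube -/

/-- The smallest coordinate of rank at least `j`. -/
def leastOfRank {m : ℕ} (ρ : Equiv.Perm (Fin (m + 1))) (j : ℕ) : Fin (m + 1) :=
  (Finset.univ.filter fun i => j ≤ (ρ i : ℕ)).inf id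

theorem leastOfRank_le {m : ℕ} (ρ : Equiv.Perm (Fin (m + 1))) {j : ℕ} {i : Fin (m + 1)}
    (h : j ≤ (ρ i : ℕ)) : leastOfRank ρ j ≤ i :=
  Finset.inf_le (f := id) (Finset.mem_filter.2 ⟨Finset.mem_univ i, h⟩)

theorem le_rank_leastOfRank {m : ℕ} (ρ : Equiv.Perm (Fin (m + 1))) {j : ℕ} (h : j ≤ m) :
    j ≤ (ρ (leastOfRank ρ j) : ℕ) := by
  have hne : (Finset.univ.filter fun i => j ≤ (ρ i : ℕ)).Nonempty :=
    ⟨ρ.symm (Fin.last m), by simpa using h⟩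
  obtain ⟨i, hi, he⟩ := Finset.exists_mem_eq_inf _ hne id
  rw [leastOfRank, he]
  exact (Finset.mem_filter.1 hi).2

theorem leastOfRank_swap {m j l : ℕ} (h0 : 0 < j) (hj : j < m + 1) (hl : l ≠ j)
    (ρ : Equiv.Perm (Fin (m + 1))) :
    leastOfRank (Equiv.swap (⟨j - 1, by omega⟩ : Fin (m + 1)) ⟨j, hj⟩ * ρ) l = leastOfRank ρ l := by
  unfold leastOfRank
  congr 1
  ext i
  have := swap_mul_lt_iff h0 hj hl ρ i
  simp only [Finset.mem_filter, Finset.mem_univ, true_and]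
  omega

theorem leastOfRank_of_strictMono {m : ℕ} (ρ : Equiv.Perm (Fin (m + 1)))
    (h : StrictMono fun l : Fin m => ρ.symm l.succ) (l : Fin m) :
    leastOfRank ρ (l + 1) = ρ.symm l.succ := by
  apply le_antisymm
  · exact leastOfRank_le ρ (by simp)
  · have h1 := le_rank_leastOfRank ρ (j := l + 1) (by omega)
    generalize leastOfRank ρ (l + 1) = i at h1
    have h0 : ρ i ≠ 0 := by
      intro h
      rw [h, Fin.val_zero] at h1
      omega
    obtain ⟨a, ha⟩ := Fin.exists_succ_eq.2 h0
    rw [← ρ.symm_apply_apply i, ← ha]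
    refine h.monotone ?_
    rw [← ha, Fin.val_succ] at h1
    exact Fin.le_def.2 (by omega)

/-- If the least coordinate of rank at least `l` did not have rank exactly `l`, it would also be the
least one of rank at least `l + 1`, against injectivity. -/
theorem strictMono_of_injOn_leastOfRank {m : ℕ} (ρ : Equiv.Perm (Fin (m + 1)))
    (h : Set.InjOn (leastOfRank ρ) (Set.Icc 1 m)) : StrictMono fun l : Fin m => ρ.symm l.succ := by
  cases m with
  | zero => exact fun a => a.elim0
  | succ m =>
    refine Fin.strictMono_iff_lt_succ.2 fun l => ?_
    have hl := l.isLt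
    have hne : leastOfRank ρ (l + 1) ≠ leastOfRank ρ (l + 2) := by
      intro he
      have := h ⟨by omega, by omega⟩ ⟨by omega, by omega⟩ he
      omega
    have h1 := le_rank_leastOfRank ρ (j := l + 1) (by omega)
    have h2 : ρ (leastOfRank ρ (l + 1)) = l.castSucc.succ := by
      apply Fin.ext
      rw [Fin.val_succ, Fin.val_castSucc]
      by_contra h3
      refine hne (le_antisymm ?_ ?_)
      · exact leastOfRank_le ρ (le_trans (by omega) (le_rank_leastOfRank ρ (by omega)))
      · exact leastOfRank_le ρ (by omega)
    rw [← h2, Equiv.symm_apply_apply]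
    refine lt_of_le_of_ne (leastOfRank_le ρ (by simp)) fun he => hne ?_
    refine le_antisymm ?_ ?_
    · exact leastOfRank_le ρ (le_trans (by omega) (le_rank_leastOfRank ρ (by omega)))
    · rw [he]
      exact leastOfRank_le ρ (by simp)

theorem eq_cycleRange_of_strictMono {m : ℕ} (ρ : Equiv.Perm (Fin (m + 1)))
    (h : StrictMono fun l : Fin m => ρ.symm l.succ) : (ρ.symm 0).cycleRange = ρ := by
  have h1 : (fun l : Fin m => ρ.symm l.succ) = (ρ.symm 0).succAbove := by
    refine (StrictMono.range_inj h (Fin.strictMono_succAbove _)).1 ?_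
    rw [Fin.range_succAbove]
    ext i
    simp only [Set.mem_range, Set.mem_compl_iff, Set.mem_singleton_iff]
    constructor
    · rintro ⟨l, rfl⟩ he
      exact Fin.succ_ne_zero l (ρ.symm.injective he)
    · intro hi
      obtain ⟨l, hl⟩ := Fin.exists_succ_eq.2 (show ρ i ≠ 0 from fun h0 => hi (by
        rw [← h0, Equiv.symm_apply_apply]))
      exact ⟨l, by rw [hl, Equiv.symm_apply_apply]⟩
  suffices h2 : (ρ.symm 0).cycleRange.symm = ρ.symm by
    rw [← Equiv.symm_symm (ρ.symm 0).cycleRange, h2, Equiv.symm_symm]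
  ext1 i
  refine Fin.cases ?_ (fun l => ?_) i
  · rw [Fin.cycleRange_symm_zero]
  · rw [Fin.cycleRange_symm_succ]
    exact (congrFun h1 l).symm

section cube

variable {m : ℕ} (w : Fin (m + 1) → ℤ)

/-- The vertex of the unit cube at `w` that is adjacent to the top vertex in the direction `i`. -/
def coatom (i : Fin (m + 1)) : Fin (m + 1) → ℤ := w + 1 - Pi.single i 1

/-- A Kuhn simplex with the vertices after the `M`-th one, except the last, moved to coatoms. -/
def movedVertex (ρ : Equiv.Perm (Fin (m + 1))) (M l : ℕ) : Fin (m + 1) → ℤ :=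
  if l ≤ M then kuhnVertex w ρ l else if l ≤ m then coatom w (leastOfRank ρ l) else w + 1

/-- The prism between two consecutive stages of the movement. -/
def prismVertex (ρ : Equiv.Perm (Fin (m + 1))) (M l : ℕ) : Fin (m + 1) → ℤ :=
  if l ≤ M then kuhnVertex w ρ l
  else if l ≤ m + 1 then coatom w (leastOfRank ρ (l - 1)) else w + 1

variable {w}

/-- A vertex moves to a coatom above it which depends only on the vertex, so the movement is a
simplicial homotopy. Each prism has an even number of rainbow facets. Two facets are the stages
being compared; the others cancel between flags or miss a color. -/
theorem sum_rainbow_movedVertex (C : (Fin (m + 1) → ℤ) → Fin (m + 2))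
    (h1 : ∃ a, ∀ x, w ≤ x → x ≤ w + 1 → x ≠ w + 1 → C x ≠ a)
    (h2 : ∀ i, ∃ a, ∀ x, w ≤ x → x ≤ w + 1 → x i = w i + 1 → C x ≠ a) {M : ℕ} (hM : M + 1 ≤ m) :
    ∑ ρ, rainbow (fun l => C (movedVertex w ρ (M + 1) l)) (Finset.range (m + 2)) =
      ∑ ρ, rainbow (fun l => C (movedVertex w ρ M l)) (Finset.range (m + 2)) := by
  have hv : ∀ (ρ : Equiv.Perm (Fin (m + 1))) l, w ≤ kuhnVertex w ρ l ∧ kuhnVertex w ρ l ≤ w + 1 := by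
    intro ρ l
    constructor <;> intro i <;> simp only [kuhnVertex, Pi.add_apply, Pi.one_apply] <;>
      split_ifs <;> omega
  have hc : ∀ i, w ≤ coatom w i ∧ coatom w i ≤ w + 1 := by
    intro i
    constructor <;> intro a <;>
      simp only [coatom, Pi.sub_apply, Pi.add_apply, Pi.one_apply, Pi.single_apply] <;>
      split_ifs <;> omega
  have hp : ∀ (ρ : Equiv.Perm (Fin (m + 1))) l,
      w ≤ prismVertex w ρ (M + 1) l ∧ prismVertex w ρ (M + 1) l ≤ w + 1 := by
    intro ρ l
    unfold prismVertex
    split_ifs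
    · exact hv ρ l
    · exact hc _
    · exact ⟨fun i => by simp, le_rfl⟩
  have hsum : ∑ ρ, ∑ j ∈ Finset.range (m + 3), rainbow (fun l => C (prismVertex w ρ (M + 1) l))
      ((Finset.range (m + 3)).erase j) = 0 :=
    Finset.sum_eq_zero fun ρ _ => sum_rainbow_erase _ _ (by simp)
  have hcard : ∀ j ∈ Finset.range (m + 3), ((Finset.range (m + 3)).erase j).card = m + 2 := by
    intro j hj
    rw [Finset.card_erase_of_mem hj, Finset.card_range]
    omega
  have hvan : ∀ j ∈ Finset.range (m + 3), j ≠ M + 1 → j ≠ M + 2 →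
      ∑ ρ, rainbow (fun l => C (prismVertex w ρ (M + 1) l)) ((Finset.range (m + 3)).erase j) = 0 := by
    intro j hj hj1 hj2
    have hj' := Finset.mem_range.1 hj
    -- All remaining vertices lie in the upper facet in the direction `ρ.symm 0`, the first
    -- coordinate increased.
    by_cases hj0 : j = 0
    · subst hj0
      refine Finset.sum_eq_zero fun ρ _ => rainbow_eq_zero ?_
      obtain ⟨a, ha⟩ := h2 (ρ.symm 0)
      refine not_injOn_of_missing (hcard 0 hj).ge a fun l hl => ha _ (hp ρ l).1 (hp ρ l).2 ?_
      have hl0 : l ≠ 0 := (Finset.mem_erase.1 hl).1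
      unfold prismVertex
      split_ifs with hl1 hl2
      · simp [kuhnVertex, Nat.pos_of_ne_zero hl0]
      · have hne : ρ.symm 0 ≠ leastOfRank ρ (l - 1) := by
          intro he
          have := le_rank_leastOfRank ρ (j := l - 1) (by omega)
          rw [← he, Equiv.apply_symm_apply, Fin.val_zero] at this
          omega
        simp [coatom, hne]
      · rfl
    by_cases hjm : j = m + 2
    · subst hjm
      refine Finset.sum_eq_zero fun ρ _ => rainbow_eq_zero ?_
      obtain ⟨a, ha⟩ := h1
      refine not_injOn_of_missing (hcard _ hj).ge a fun l hl => ha _ (hp ρ l).1 (hp ρ l).2 ?_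
      have hl0 := Finset.mem_erase.1 hl
      rw [Finset.mem_range] at hl0
      unfold prismVertex
      intro he
      split_ifs at he with hl1 hl2
      · have := congrFun he (ρ.symm (Fin.last m))
        simp only [kuhnVertex, Equiv.apply_symm_apply, Fin.val_last, Pi.add_apply,
          Pi.one_apply] at this
        rw [if_neg (by omega)] at this
        omega
      · have := congrFun he (leastOfRank ρ (l - 1))
        simp [coatom] at this
      · omega
    -- The omitted vertex is the `j`-th one of the flag here, but the moved copy of the `(j - 1)`-st
    -- one in the other case; hence the shift in the transposed ranks.
    by_cases hjM : j < M + 1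
    · refine sum_perm_interior CharTwo.add_self_eq_zero (j := j) (by omega) (by omega) _ fun ρ => ?_
      refine rainbow_congr fun l hl => congrArg C ?_
      have hl0 := (Finset.mem_erase.1 hl).1
      unfold prismVertex
      split_ifs with hl1 hl2
      · funext i
        simp only [kuhnVertex]
        exact congrArg _ (if_congr (swap_mul_lt_iff (by omega) (by omega) hl0 ρ i) rfl rfl)
      · rw [leastOfRank_swap (by omega) (by omega) (by omega)]
      · rfl
    · refine sum_perm_interior CharTwo.add_self_eq_zero (j := j - 1) (by omega) (by omega) _
        fun ρ => ?_
      refine rainbow_congr fun l hl => congrArg C ?_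
      have hl0 := (Finset.mem_erase.1 hl).1
      unfold prismVertex
      split_ifs with hl1 hl2
      · funext i
        simp only [kuhnVertex]
        exact congrArg _ (if_congr (swap_mul_lt_iff (by omega) (by omega) (by omega) ρ i) rfl rfl)
      · rw [leastOfRank_swap (by omega) (by omega) (by omega)]
      · rfl
  have hm1 : M + 1 ∈ Finset.range (m + 3) := Finset.mem_range.2 (by omega)
  have hm2 : M + 2 ∈ (Finset.range (m + 3)).erase (M + 1) :=
    Finset.mem_erase.2 ⟨by omega, Finset.mem_range.2 (by omega)⟩
  rw [Finset.sum_comm, ← Finset.add_sum_erase _ _ hm1, ← Finset.add_sum_erase _ _ hm2,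
    Finset.sum_eq_zero (s := ((Finset.range (m + 3)).erase (M + 1)).erase (M + 2)),
    add_zero] at hsum
  · have e1 : ∀ ρ : Equiv.Perm (Fin (m + 1)), rainbow (fun l => C (prismVertex w ρ (M + 1) l))
        ((Finset.range (m + 3)).erase (M + 1)) =
        rainbow (fun l => C (movedVertex w ρ M l)) (Finset.range (m + 2)) := by
      intro ρ
      rw [rainbow_range_erase _ (by omega)]
      refine rainbow_congr fun l hl => congrArg C ?_
      have := Finset.mem_range.1 hl
      unfold prismVertex movedVertex
      by_cases hl1 : l ≤ M
      · rw [if_pos (by omega : l < M + 1), if_pos (by omega), if_pos hl1]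
      · rw [if_neg (by omega : ¬ l < M + 1), if_neg (by omega), if_neg hl1]
        refine if_congr (by omega) (by rw [Nat.add_sub_cancel]) rfl
    have e2 : ∀ ρ : Equiv.Perm (Fin (m + 1)), rainbow (fun l => C (prismVertex w ρ (M + 1) l))
        ((Finset.range (m + 3)).erase (M + 2)) =
        rainbow (fun l => C (movedVertex w ρ (M + 1) l)) (Finset.range (m + 2)) := by
      intro ρ
      rw [rainbow_range_erase _ (by omega)]
      refine rainbow_congr fun l hl => congrArg C ?_
      have := Finset.mem_range.1 hl
      unfold prismVertex movedVertex
      by_cases hl1 : l ≤ M + 1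
      · rw [if_pos (by omega : l < M + 2), if_pos (by omega), if_pos hl1]
      · rw [if_neg (by omega : ¬ l < M + 2), if_neg (by omega), if_neg hl1]
        refine if_congr (by omega) (by rw [Nat.add_sub_cancel]) rfl
    simp only [e1, e2] at hsum
    exact (CharTwo.add_eq_zero.1 hsum).symm
  · intro j hj
    obtain ⟨hj2, hj⟩ := Finset.mem_erase.1 hj
    obtain ⟨hj1, hj⟩ := Finset.mem_erase.1 hj
    exact hvan j hj hj1 hj2

/-- After the full movement only `w`, coatoms and the top remain. A flag whose coatoms are distinct
is determined by the coatom it omits, so the sum runs over facets of the simplex on `w`, all coatoms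
and the top. The two facets not counted, opposite `w` and opposite the top, miss a color. -/
theorem sum_rainbow_movedVertex_zero (C : (Fin (m + 1) → ℤ) → Fin (m + 2))
    (h1 : ∃ a, ∀ x, w ≤ x → x ≤ w + 1 → x ≠ w + 1 → C x ≠ a)
    (h3 : ∃ a, C (w + 1) ≠ a ∧ ∀ i, C (coatom w i) ≠ a) :
    ∑ ρ, rainbow (fun l => C (movedVertex w ρ 0 l)) (Finset.range (m + 2)) = 0 := by
  classical
  set U : ℕ → Fin (m + 2) := fun l => if l = 0 then C w else
    if h : l - 1 < m + 1 then C (coatom w ⟨l - 1, h⟩) else C (w + 1) with hU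
  have hsum := sum_rainbow_erase U (Finset.range (m + 3)) (by simp)
  have hcard : ∀ j ∈ Finset.range (m + 3), ((Finset.range (m + 3)).erase j).card = m + 2 := by
    intro j hj
    rw [Finset.card_erase_of_mem hj, Finset.card_range]
    omega
  have hfirst : rainbow U ((Finset.range (m + 3)).erase 0) = 0 := by
    obtain ⟨a, ha, ha'⟩ := h3
    refine rainbow_eq_zero (not_injOn_of_missing (hcard _ (by simp)).ge a fun l hl => ?_)
    simp only [hU]
    rw [if_neg (Finset.mem_erase.1 hl).1]
    split_ifs
    · exact ha' _
    · exact ha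
  have hlast : rainbow U ((Finset.range (m + 3)).erase (m + 2)) = 0 := by
    obtain ⟨a, ha⟩ := h1
    refine rainbow_eq_zero (not_injOn_of_missing (hcard _ (by simp)).ge a fun l hl => ?_)
    have hl' := Finset.mem_erase.1 hl
    rw [Finset.mem_range] at hl'
    simp only [hU]
    split_ifs with hl1 hl2
    · refine ha _ le_rfl (fun i => by simp) fun h => ?_
      have := congrFun h 0
      simp at this
    · refine ha _ ?_ ?_ fun h => ?_
      · intro b
        simp only [coatom, Pi.sub_apply, Pi.add_apply, Pi.one_apply, Pi.single_apply]
        split_ifs <;> omega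
      · intro b
        simp only [coatom, Pi.sub_apply, Pi.add_apply, Pi.one_apply, Pi.single_apply]
        split_ifs <;> omega
      · have := congrFun h ⟨l - 1, hl2⟩
        simp [coatom] at this
    · omega
  rw [Finset.sum_range_succ, hlast, add_zero, Finset.sum_range_succ', hfirst, add_zero,
    Finset.sum_range] at hsum
  rw [← hsum, ← Finset.sum_filter_add_sum_filter_not _
    fun ρ : Equiv.Perm (Fin (m + 1)) => StrictMono fun l : Fin m => ρ.symm l.succ]
  rw [Finset.sum_eq_zero (s := Finset.univ.filter fun ρ : Equiv.Perm (Fin (m + 1)) =>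
    ¬ StrictMono fun l : Fin m => ρ.symm l.succ), add_zero]
  · refine Finset.sum_bij' (fun ρ _ => ρ.symm 0) (fun r _ => r.cycleRange) ?_ ?_ ?_ ?_ ?_
    · intro ρ _; exact Finset.mem_univ _
    · intro r _
      refine Finset.mem_filter.2 ⟨Finset.mem_univ _, ?_⟩
      simp only [Fin.cycleRange_symm_succ]
      exact Fin.strictMono_succAbove r
    · intro ρ hρ
      exact eq_cycleRange_of_strictMono ρ (Finset.mem_filter.1 hρ).2
    · intro r _
      exact Fin.cycleRange_symm_zero r
    · intro ρ hρ
      have hmono := (Finset.mem_filter.1 hρ).2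
      have hρ' := eq_cycleRange_of_strictMono ρ hmono
      generalize ρ.symm 0 = r at hρ'
      subst hρ'
      rw [rainbow_range_erase _ (by omega)]
      refine rainbow_congr fun l hl => ?_
      have hl' := Finset.mem_range.1 hl
      have hr := r.isLt
      rcases Nat.eq_zero_or_pos l with rfl | hl0
      · rw [if_pos (by omega)]
        simp only [hU, if_true, movedVertex, le_refl]
        congr 1
        funext i
        simp [kuhnVertex]
      · simp only [hU, movedVertex]
        rw [if_neg (by omega : ¬ l ≤ 0)]
        by_cases hlm : l ≤ m
        · have hs := leastOfRank_of_strictMono _ hmono ⟨l - 1, by omega⟩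
          simp only [Nat.sub_add_cancel hl0] at hs
          rw [Fin.cycleRange_symm_succ] at hs
          rw [if_pos hlm, hs]
          by_cases hlr : l < r + 1
          · rw [if_pos hlr, if_neg (by omega), dif_pos (by omega)]
            congr 2
            rw [Fin.succAbove_of_castSucc_lt]
            · rfl
            · rw [Fin.lt_def]
              simp only [Fin.val_castSucc]
              omega
          · rw [if_neg hlr, if_neg (by omega), dif_pos (by omega)]
            congr 2
            rw [Fin.succAbove_of_le_castSucc]
            · apply Fin.ext
              simp only [Fin.val_succ]
              omega
            · rw [Fin.le_def]
              simp only [Fin.val_castSucc]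
              omega
        · rw [if_neg hlm, if_neg (by omega : ¬ l < r + 1), if_neg (by omega), dif_neg (by omega)]
  · intro ρ hρ
    refine rainbow_eq_zero fun h => (Finset.mem_filter.1 hρ).2 ?_
    refine strictMono_of_injOn_leastOfRank ρ fun a ha b hb hab => ?_
    obtain ⟨ha1, ha2⟩ := ha
    obtain ⟨hb1, hb2⟩ := hb
    refine h (by simp; omega) (by simp; omega) ?_
    simp only [movedVertex]
    rw [if_neg (by omega : ¬ a ≤ 0), if_neg (by omega : ¬ b ≤ 0), if_pos ha2, if_pos hb2, hab]

/-- A coloring of the vertices of a cube, in which the nontop vertices miss a color, each upper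
facet misses a color, and the two highest levels miss a color, has an even number of rainbow Kuhn
simplices. -/
theorem sum_rainbow_kuhnSimplex (C : (Fin (m + 1) → ℤ) → Fin (m + 2))
    (h1 : ∃ a, ∀ x, w ≤ x → x ≤ w + 1 → x ≠ w + 1 → C x ≠ a)
    (h2 : ∀ i, ∃ a, ∀ x, w ≤ x → x ≤ w + 1 → x i = w i + 1 → C x ≠ a)
    (h3 : ∃ a, C (w + 1) ≠ a ∧ ∀ i, C (coatom w i) ≠ a) :
    ∑ ρ, rainbow C (kuhnSimplex w ρ) = 0 := by
  have key : ∀ M ≤ m,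
      ∑ ρ, rainbow (fun l => C (movedVertex w ρ M l)) (Finset.range (m + 2)) = 0 := by
    intro M
    induction M with
    | zero => exact fun _ => sum_rainbow_movedVertex_zero C h1 h3
    | succ M ih => exact fun hM => (sum_rainbow_movedVertex C h1 h2 hM).trans (ih (by omega))
  rw [← key m le_rfl]
  refine Finset.sum_congr rfl fun ρ _ => ?_
  have : rainbow C (kuhnSimplex w ρ) =
      rainbow (fun l => C (kuhnVertex w ρ l)) (Finset.range (m + 2)) := by
    apply rainbow_eq_of_iff
    rw [kuhnSimplex, Finset.coe_image]
    constructor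
    · intro h a ha b hb hab
      exact kuhnVertex_injOn w ρ ha hb (h ⟨a, ha, rfl⟩ ⟨b, hb, rfl⟩ hab)
    · rintro h _ ⟨a, ha, rfl⟩ _ ⟨b, hb, rfl⟩ hab
      rw [h ha hb hab]
  rw [this]
  refine rainbow_congr fun l hl => congrArg C ?_
  have hl' := Finset.mem_range.1 hl
  unfold movedVertex
  by_cases hlm : l ≤ m
  · rw [if_pos hlm]
  · rw [if_neg hlm, if_neg hlm]
    funext i
    have := (ρ i).isLt
    simp only [kuhnVertex, Pi.add_apply, Pi.one_apply]
    rw [if_pos (by omega)]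

end cube

/-! ### Sandwich membership and the lexicographic order -/

theorem mem_discreteCube_of_le {k : ℕ} {w x : Fin k → ℤ} (h1 : w ≤ x) (h2 : x ≤ w + 1) :
    x - w ∈ discreteCube k := by
  intro i
  have := h1 i
  have := h2 i
  simp only [Pi.add_apply, Pi.one_apply, Pi.sub_apply] at *
  omega

theorem sum_lt_of_mem_discreteCube {k : ℕ} {x : Fin k → ℤ} (hx : x ∈ discreteCube k)
    (h : ∃ a, x a = 0) : ∑ i, x i < k := by
  obtain ⟨a, ha⟩ := h
  calc ∑ i, x i < ∑ _i : Fin k, (1 : ℤ) := Finset.sum_lt_sum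
        (fun i _ => by rcases hx i with h | h <;> omega) ⟨a, Finset.mem_univ a, by omega⟩
    _ = k := by simp

theorem mem_sandwich_zero {k : ℕ} {s : ℝ} {x : Fin k → ℤ} (hx : x ∈ discreteCube k)
    (h : ∑ i, x i < k) : (0, x) ∈ sandwich k s :=
  Or.inl (Or.inr ⟨rfl, hx, by exact_mod_cast h⟩)

theorem mem_sandwich_one {k : ℕ} {s : ℝ} {x : Fin k → ℤ} (hx : x ∈ discreteCube k)
    (h : s < ((∑ i, x i : ℤ) : ℝ)) : (1, x) ∈ sandwich k s :=
  Or.inr ⟨rfl, hx, h⟩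

theorem mem_sandwich_neg_one {k : ℕ} {s : ℝ} {x : Fin k → ℤ} (hx : x ∈ discreteCube k)
    (h : ((∑ i, x i : ℤ) : ℝ) < s) : (-1, x) ∈ sandwich k s :=
  Or.inl (Or.inl ⟨rfl, hx, h⟩)

/-- The first nonzero coordinate is positive. -/
def LexPos {m : ℕ} (v : Fin m → ℤ) : Prop := ∃ i, (∀ j < i, v j = 0) ∧ 0 < v i

theorem exists_first_ne_zero {m : ℕ} {v : Fin m → ℤ} (hv : v ≠ 0) :
    ∃ i, (∀ j < i, v j = 0) ∧ v i ≠ 0 := by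
  obtain ⟨i, hi⟩ := Function.ne_iff.1 hv
  obtain ⟨a, ha, hmin⟩ := WellFounded.has_min (wellFounded_lt (α := Fin m)) {i | v i ≠ 0} ⟨i, hi⟩
  exact ⟨a, fun j hj => by_contra fun h => hmin j h hj, ha⟩

theorem lexPos_iff {m : ℕ} {v : Fin m → ℤ} {i : Fin m} (h : ∀ j < i, v j = 0) (hi : v i ≠ 0) :
    LexPos v ↔ 0 < v i := by
  constructor
  · rintro ⟨a, ha, ha'⟩
    rcases lt_trichotomy a i with hlt | rfl | hlt
    · exact absurd (h a hlt) ha'.ne'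
    · exact ha'
    · exact absurd (ha i hlt) hi
  · exact fun h' => ⟨i, h, h'⟩

theorem lexPos_neg {m : ℕ} {v : Fin m → ℤ} (hv : v ≠ 0) : LexPos (-v) ↔ ¬ LexPos v := by
  obtain ⟨i, h, hi⟩ := exists_first_ne_zero hv
  rw [lexPos_iff h hi, lexPos_iff (v := -v) (i := i) (fun j hj => by simp [h j hj]) (by simpa)]
  simp only [Pi.neg_apply]
  omega

theorem LexPos.mono {m : ℕ} {u v : Fin m → ℤ} (hu : LexPos u) (h : u ≤ v) : LexPos v := by
  obtain ⟨i, h1, h2⟩ := hu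
  have hv : v ≠ 0 := fun h0 => by
    have := h i
    simp only [h0, Pi.zero_apply] at this
    omega
  obtain ⟨a, ha, ha'⟩ := exists_first_ne_zero hv
  refine (lexPos_iff ha ha').2 ?_
  have h3 : u a ≤ v a := h a
  rcases lt_trichotomy a i with hlt | rfl | hlt
  · rw [h1 a hlt] at h3
    omega
  · omega
  · have : u i ≤ v i := h i
    rw [ha i hlt] at this
    omega

theorem LexPos.zero_le {m : ℕ} {v : Fin (m + 1) → ℤ} (h : LexPos v) : 0 ≤ v 0 := by
  obtain ⟨i, h1, h2⟩ := h
  rcases (Fin.zero_le i).eq_or_lt with rfl | hlt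
  · exact h2.le
  · exact (h1 0 hlt).ge

theorem lexPos_of_zero_lt {m : ℕ} {v : Fin (m + 1) → ℤ} (h : 0 < v 0) : LexPos v :=
  ⟨0, fun j hj => absurd hj (Fin.not_lt_zero j), h⟩

/-! ### The Fan labelling induced by a separating coloring -/

section core

variable {k : ℕ}

/-- The point of `ℤ × ℤ^k` that gives the color to a lexicographically positive point: the layers
`0` and `1` both go to the layer `0`. -/
def basePoint (v : Fin (k + 1) → ℤ) : ℤ × (Fin k → ℤ) := (max (v 0 - 1) 0, fun a => v a.succ)

open Classical in
/-- The symmetric coloring that is induced on the points of `ℤ^(k+1)`. -/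
noncomputable def symmetricColor (χ : ℤ × (Fin k → ℤ) → Fin (k + 1)) (v : Fin (k + 1) → ℤ) :
    Fin (k + 1) :=
  if LexPos v then χ (basePoint v) else χ (basePoint (-v))

open Classical in
/-- The side of a point: `0` for the lexicographically positive points, `1` for the others. -/
noncomputable def lexSide {m : ℕ} (v : Fin m → ℤ) : ZMod 2 := if LexPos v then 0 else 1

theorem lexSide_eq_zero_iff {m : ℕ} {v : Fin m → ℤ} : lexSide v = 0 ↔ LexPos v := by
  unfold lexSide
  split_ifs with h <;> simp [h]

/-- The sign of a point for the coloring `χ`. -/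
noncomputable def colorSign (χ : ℤ × (Fin k → ℤ) → Fin (k + 1)) (v : Fin (k + 1) → ℤ) : ZMod 2 :=
  lexSide v + ((symmetricColor χ v : ℕ) : ZMod 2)

/-- Points whose sum is in the sandwich have distinct colors if the first one has a coordinate of
absolute value at least `R₀`. -/
def SeparatesSandwich (s : ℝ) (χ : ℤ × (Fin k → ℤ) → Fin (k + 1)) (R₀ : ℤ) : Prop :=
  ∀ u v, u + v ∈ sandwich k s → (R₀ ≤ |u.1| ∨ ∃ i, R₀ ≤ |u.2 i|) → χ u ≠ χ v

variable {s : ℝ} {χ : ℤ × (Fin k → ℤ) → Fin (k + 1)} {R₀ R : ℤ}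

/-- Antisymmetry is built into the labelling. The essential point is the absence of edges with equal
colors and opposite sides on the boundary. -/
theorem SeparatesSandwich.isFanLabelling (h : SeparatesSandwich s χ R₀) (hR : R₀ ≤ R)
    (hR2 : 2 ≤ R) :
    IsFanLabelling R (k + 1) (fun v => (symmetricColor χ v : ℕ)) (colorSign χ) := by
  have hneg : ∀ v, symmetricColor χ (-v) = symmetricColor χ v := by
    intro v
    by_cases hv : v = 0
    · subst hv
      rw [neg_zero]
    unfold symmetricColor
    by_cases hl : LexPos v
    · rw [if_pos hl, if_neg (by rw [lexPos_neg hv]; simpa using hl), neg_neg]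
    · rw [if_neg hl, if_pos ((lexPos_neg hv).2 hl)]
  refine ⟨fun v => (symmetricColor χ v).isLt, fun v => by simp only [hneg], fun v hv => ?_,
    fun u v huv hvu hi hc => ?_⟩
  · unfold colorSign
    rw [hneg]
    have : lexSide (-v) = lexSide v + 1 := by
      unfold lexSide
      by_cases hl : LexPos v
      · rw [if_pos hl, if_neg (by rw [lexPos_neg hv]; simpa using hl), zero_add]
      · rw [if_neg hl, if_pos ((lexPos_neg hv).2 hl)]
        rfl
    rw [this]
    ring
  · have hc' : symmetricColor χ u = symmetricColor χ v := Fin.ext hc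
    unfold colorSign
    rw [hc']
    congr 1
    unfold lexSide
    by_cases hu : LexPos u
    · rw [if_pos hu, if_pos (hu.mono huv)]
    · by_cases hv : LexPos v
      · exfalso
        obtain ⟨i, hi, hiR⟩ := hi
        have hu0 : u ≠ 0 := by
          rintro rfl
          rw [Pi.zero_apply, abs_zero] at hiR
          omega
        have hu' : LexPos (-u) := (lexPos_neg hu0).2 hu
        have e1 := hu'.zero_le
        have e2 := hv.zero_le
        have e3 := hvu 0
        simp only [Pi.neg_apply, Pi.add_apply, Pi.one_apply] at e1 e3
        unfold symmetricColor at hc'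
        rw [if_neg hu, if_pos hv] at hc'
        have hi0 : i ≠ 0 := by
          rintro rfl
          rw [abs_of_nonpos (by omega)] at hiR
          omega
        obtain ⟨a, rfl⟩ := Fin.exists_succ_eq.2 hi0
        refine h _ _ ?_ (Or.inr ⟨a, ?_⟩) hc'
        -- Here `-u 0` and `v 0` are `0` or `1`, and `basePoint` sends both layers to `0`. The sum
        -- thus falls in the middle layer, and is not its top point because `u` and `v` agree in the
        -- coordinate `a`.
        · have hsum : basePoint (-u) + basePoint v =
              (0, (fun a => v (Fin.succ a)) - fun a => u (Fin.succ a)) := by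
            refine Prod.ext ?_ ?_
            · simp only [basePoint, Prod.fst_add, Pi.neg_apply]
              omega
            · funext b
              simp only [basePoint, Prod.snd_add, Pi.neg_apply, Pi.add_apply, Pi.sub_apply]
              omega
          rw [hsum]
          have hcube := mem_discreteCube_of_le (w := fun a => u (Fin.succ a))
            (x := fun a => v (Fin.succ a)) (fun b => huv b.succ) (fun b => hvu b.succ)
          exact mem_sandwich_zero hcube
            (sum_lt_of_mem_discreteCube hcube ⟨a, by simp [hi]⟩)
        · simp only [basePoint, Pi.neg_apply, abs_neg]
          omega
      · rw [if_neg hu, if_neg hv]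

/-- The displacement of the `j`-th vertex of a Kuhn simplex of a facet, without the first
coordinate. -/
def tailStep (ρ : Equiv.Perm (Fin (k + 1))) (j : ℕ) : Fin k → ℤ :=
  fun i => if 0 < (ρ i.succ : ℕ) ∧ (ρ i.succ : ℕ) ≤ j then 1 else 0

theorem tailStep_mem (ρ : Equiv.Perm (Fin (k + 1))) (j : ℕ) : tailStep ρ j ∈ discreteCube k := by
  intro i
  unfold tailStep
  split_ifs
  · exact Or.inr rfl
  · exact Or.inl rfl

theorem sum_tailStep (ρ : Equiv.Perm (Fin (k + 1))) (j : ℕ) : ∑ i, tailStep ρ j i =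
    (Finset.univ.filter fun i : Fin k => 0 < (ρ i.succ : ℕ) ∧ (ρ i.succ : ℕ) ≤ j).card := by
  simp [tailStep]

theorem sum_tailStep_le (ρ : Equiv.Perm (Fin (k + 1))) (j : ℕ) : ∑ i, tailStep ρ j i ≤ j := by
  rw [sum_tailStep]
  have := Finset.card_le_card_of_injOn (s := Finset.univ.filter fun i : Fin k =>
    0 < (ρ i.succ : ℕ) ∧ (ρ i.succ : ℕ) ≤ j) (t := Finset.Ioc 0 j) (fun i => (ρ i.succ : ℕ))
    (fun i hi => by simpa using hi)
    (fun a _ b _ hab => Fin.succ_injective _ (ρ.injective (Fin.ext hab)))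
  rw [Nat.card_Ioc] at this
  omega

theorem le_sum_tailStep (ρ : Equiv.Perm (Fin (k + 1))) {j : ℕ} (hj : (ρ 0 : ℕ) ≤ j) :
    (ρ 0 : ℕ) - 1 ≤ ∑ i, tailStep ρ j i := by
  rw [sum_tailStep]
  have h := Finset.card_le_card_of_surjOn (s := Finset.univ.filter fun i : Fin k =>
    0 < (ρ i.succ : ℕ) ∧ (ρ i.succ : ℕ) ≤ j) (t := Finset.Ioo 0 (ρ 0 : ℕ))
    (fun i => (ρ i.succ : ℕ)) (fun l hl => by
      simp only [Finset.coe_Ioo, Set.mem_Ioo] at hl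
      have hlt := (ρ 0).isLt
      have hne : ρ.symm ⟨l, by omega⟩ ≠ 0 := by
        intro he
        rw [Equiv.symm_apply_eq] at he
        have := congrArg Fin.val he
        simp only at this
        omega
      obtain ⟨a, ha⟩ := Fin.exists_succ_eq.2 hne
      have hv : (ρ a.succ : ℕ) = l := by rw [ha, Equiv.apply_symm_apply]
      exact ⟨a, Finset.mem_coe.2 (Finset.mem_filter.2 ⟨Finset.mem_univ a, by omega, by omega⟩), hv⟩)
  rw [Nat.card_Ioo] at h
  omega

theorem basePoint_kuhnFaceVertex (w : Fin (k + 1) → ℤ) (ρ : Equiv.Perm (Fin (k + 1))) (j : ℕ) :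
    (basePoint (kuhnFaceVertex w ρ j)).2 = (fun a => w (Fin.succ a)) + tailStep ρ j := rfl

/-- The points of a simplex in a side of the box have a common neighbor. -/
theorem exists_common_neighbor (hs : s ≤ (k : ℝ) - 2) (w : Fin (k + 1) → ℤ)
    (ρ : Equiv.Perm (Fin (k + 1))) (hρ : ρ 0 ≠ 0) (hw : 0 ≤ w 0) :
    ∃ q, ∀ j, basePoint (kuhnFaceVertex w ρ j) + q ∈ sandwich k s := by
  have hρ0 : 0 < (ρ 0 : ℕ) := Nat.pos_of_ne_zero fun h => hρ (Fin.ext h)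
  have h1 : ρ.symm 0 ≠ 0 := fun h => hρ (by rw [← h, Equiv.apply_symm_apply, h])
  obtain ⟨a, ha⟩ := Fin.exists_succ_eq.2 h1
  have hρa : ρ a.succ = 0 := by rw [ha, Equiv.apply_symm_apply]
  have hzero : ∀ j, tailStep ρ j a = 0 := by
    intro j
    simp [tailStep, hρa]
  have hlt : ∀ j, ∑ i, tailStep ρ j i < k := fun j =>
    sum_lt_of_mem_discreteCube (tailStep_mem ρ j) ⟨a, hzero j⟩
  set w' : Fin k → ℤ := fun a => w (Fin.succ a) with hw'
  have hfst : ∀ j, (basePoint (kuhnFaceVertex w ρ j)).1 =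
      max (w 0 + (if (ρ 0 : ℕ) ≤ j then 1 else 0) - 1) 0 := by
    intro j
    simp only [basePoint, kuhnFaceVertex, hρ0, true_and]
  have hadd : ∀ j (t : ℤ) (y : Fin k → ℤ), basePoint (kuhnFaceVertex w ρ j) + (t, -w' + y) =
      (max (w 0 + (if (ρ 0 : ℕ) ≤ j then 1 else 0) - 1) 0 + t, tailStep ρ j + y) := by
    intro j t y
    refine Prod.ext ?_ ?_
    · rw [Prod.fst_add, hfst]
    · rw [Prod.snd_add, basePoint_kuhnFaceVertex]
      simp only [← hw']
      abel
  -- Layers `0` and `1` have the same base layer, so for `w 0 = 0` the middle layer suffices.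
  rcases hw.eq_or_lt with h0 | h0
  · refine ⟨(0, -w' + 0), fun j => ?_⟩
    rw [hadd, add_zero, add_zero]
    have : max (w 0 + (if (ρ 0 : ℕ) ≤ j then 1 else 0) - 1) 0 = 0 := by
      split_ifs <;> omega
    rw [this]
    exact mem_sandwich_zero (tailStep_mem ρ j) (hlt j)
  -- The vertices before the jump of the first coordinate have tail sums at most `ρ 0 - 1`, those
  -- after it at least `ρ 0 - 1`. Comparison with `s` decides whether the two base layers are
  -- translated to `0, 1` or to `-1, 0`.
  rcases lt_trichotomy s ((ρ 0 : ℕ) - 1 : ℝ) with hc | hc | hc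
  · refine ⟨(-(w 0 - 1), -w' + 0), fun j => ?_⟩
    rw [hadd, add_zero]
    by_cases hj : (ρ 0 : ℕ) ≤ j
    · rw [if_pos hj]
      have : max (w 0 + 1 - 1) 0 + -(w 0 - 1) = 1 := by omega
      rw [this]
      refine mem_sandwich_one (tailStep_mem ρ j) (hc.trans_le ?_)
      exact_mod_cast le_sum_tailStep ρ hj
    · rw [if_neg hj]
      have : max (w 0 + 0 - 1) 0 + -(w 0 - 1) = 0 := by omega
      rw [this]
      exact mem_sandwich_zero (tailStep_mem ρ j) (hlt j)
  -- In the tie `s = ρ 0 - 1`, the constant coordinate `a` is raised: the upper sums then exceed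
  -- `s`, and the lower ones stay at most `ρ 0 = s + 1 < k`.
  · refine ⟨(-(w 0 - 1), -w' + Pi.single a 1), fun j => ?_⟩
    rw [hadd]
    have hcube : tailStep ρ j + Pi.single a 1 ∈ discreteCube k := by
      intro i
      by_cases hi : i = a
      · subst hi
        simp [hzero j]
      · simpa [hi] using tailStep_mem ρ j i
    have hsum : ∑ i, (tailStep ρ j + Pi.single a 1 : Fin k → ℤ) i = ∑ i, tailStep ρ j i + 1 := by
      simp [Finset.sum_add_distrib]
    by_cases hj : (ρ 0 : ℕ) ≤ j
    · rw [if_pos hj]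
      have : max (w 0 + 1 - 1) 0 + -(w 0 - 1) = 1 := by omega
      rw [this]
      refine mem_sandwich_one hcube ?_
      rw [hsum, hc]
      have := le_sum_tailStep ρ hj
      have h2 : ((ρ 0 : ℕ) : ℤ) < ∑ i, tailStep ρ j i + 1 + 1 := by omega
      have h3 : (((ρ 0 : ℕ) : ℤ) : ℝ) < ((∑ i, tailStep ρ j i + 1 + 1 : ℤ) : ℝ) :=
        Int.cast_lt.2 h2
      push_cast at h3 ⊢
      linarith
    · rw [if_neg hj]
      have : max (w 0 + 0 - 1) 0 + -(w 0 - 1) = 0 := by omega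
      rw [this]
      refine mem_sandwich_zero hcube ?_
      rw [hsum]
      have h2 := sum_tailStep_le ρ j
      rw [hc] at hs
      have h3 : ((ρ 0 : ℕ) : ℝ) + 1 ≤ k := by linarith
      have h4 : (ρ 0 : ℕ) + 1 ≤ k := by exact_mod_cast h3
      omega
  · refine ⟨(-w 0, -w' + 0), fun j => ?_⟩
    rw [hadd, add_zero]
    by_cases hj : (ρ 0 : ℕ) ≤ j
    · rw [if_pos hj]
      have : max (w 0 + 1 - 1) 0 + -w 0 = 0 := by omega
      rw [this]
      exact mem_sandwich_zero (tailStep_mem ρ j) (hlt j)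
    · rw [if_neg hj]
      have : max (w 0 + 0 - 1) 0 + -w 0 = -1 := by omega
      rw [this]
      refine mem_sandwich_neg_one (tailStep_mem ρ j) (lt_of_le_of_lt ?_ hc)
      have h2 := sum_tailStep_le ρ j
      have h3 : ∑ i, tailStep ρ j i + 1 ≤ ((ρ 0 : ℕ) : ℤ) := by omega
      have h4 : ((∑ i, tailStep ρ j i + 1 : ℤ) : ℝ) ≤ (((ρ 0 : ℕ) : ℤ) : ℝ) := Int.cast_le.2 h3
      push_cast at h4 ⊢
      linarith

theorem kuhnFace_card {d : ℕ} (w : Fin (d + 1) → ℤ) (ρ : Equiv.Perm (Fin (d + 1))) :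
    (kuhnFace w ρ).card = d + 1 := by
  rw [kuhnFace, Finset.card_image_of_injOn, Finset.card_range]
  have key : ∀ j j' : ℕ, j < j' → j' < d + 1 → kuhnFaceVertex w ρ j ≠ kuhnFaceVertex w ρ j' := by
    intro j j' h h' he
    have := congrFun he (ρ.symm ⟨j', h'⟩)
    simp only [kuhnFaceVertex, Equiv.apply_symm_apply] at this
    rw [if_neg (by omega), if_pos (by omega)] at this
    omega
  intro j hj j' hj' he
  simp only [Finset.coe_range, Set.mem_Iio] at hj hj'
  rcases lt_trichotomy j j' with h | h | h
  · exact absurd he (key _ _ h hj')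
  · exact h
  · exact absurd he.symm (key _ _ h hj)

/-- The starting sign `(k + 1) + 1` makes the constant value of sign plus color vanish; the color
cancels and `lexSide` is `0` at every vertex. -/
theorem lexPos_of_alternating_ne_zero {σ : Finset (Fin (k + 1) → ℤ)} (hσ : σ.card = k + 1)
    (h : alternating (fun v => (symmetricColor χ v : ℕ)) (colorSign χ) (k + 1)
      (((k + 1 : ℕ) : ZMod 2) + 1) σ ≠ 0) :
    Set.InjOn (symmetricColor χ) σ ∧ ∀ v ∈ σ, LexPos v := by
  obtain ⟨-, h1, h2⟩ := alternating_full h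
  refine ⟨fun x hx y hy hxy => h1 hx hy (congrArg Fin.val hxy), fun v hv => ?_⟩
  have := h2 hσ v hv
  rw [colorSign, add_assoc, CharTwo.add_self_eq_zero, add_zero,
    add_assoc (((k + 1 : ℕ) : ZMod 2) + 1), CharTwo.add_self_eq_zero] at this
  exact lexSide_eq_zero_iff.1 this

/-- A positive rainbow simplex would use the color of the common neighbor. The antipodal simplex has
a vertex with negative first coordinate, so it is not positive. -/
theorem SeparatesSandwich.alternating_side (h : SeparatesSandwich s χ R₀) (hs : s ≤ (k : ℝ) - 2)
    (hR : R₀ ≤ R) (w : Fin (k + 1) → ℤ) (ρ : Equiv.Perm (Fin (k + 1))) (hρ : ρ 0 ≠ 0)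
    (hwR : |w (ρ.symm 0)| = R) (hw : 0 ≤ w 0) :
    alternating (fun v => (symmetricColor χ v : ℕ)) (colorSign χ) (k + 1)
      (((k + 1 : ℕ) : ZMod 2) + 1) (kuhnFace w ρ) = 0 ∧
    alternating (fun v => (symmetricColor χ v : ℕ)) (colorSign χ) (k + 1)
      (((k + 1 : ℕ) : ZMod 2) + 1) ((kuhnFace w ρ).image fun v => -v) = 0 := by
  have hcard := kuhnFace_card w ρ
  constructor
  · by_contra hne
    obtain ⟨h1, h2⟩ := lexPos_of_alternating_ne_zero hcard hne
    obtain ⟨q, hq⟩ := exists_common_neighbor hs w ρ hρ hw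
    refine not_injOn_of_missing hcard.ge (χ q) (fun v hv => ?_) h1
    have hv' := h2 v hv
    obtain ⟨j, _, rfl⟩ := Finset.mem_image.1 hv
    rw [symmetricColor, if_pos hv']
    refine h _ _ (hq j) (Or.inr ?_)
    have h3 : ρ.symm 0 ≠ 0 := fun h => hρ (by rw [← h, Equiv.apply_symm_apply, h])
    obtain ⟨a, ha⟩ := Fin.exists_succ_eq.2 h3
    refine ⟨a, ?_⟩
    simp only [basePoint]
    rw [ha, kuhnFaceVertex_symm_zero, hwR]
    exact hR
  · by_contra hne
    obtain ⟨-, h2⟩ := lexPos_of_alternating_ne_zero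
      (by rw [Finset.card_image_of_injective _ neg_injective, hcard]) hne
    have h3 := (h2 _ (Finset.mem_image_of_mem _
      (Finset.mem_image_of_mem (kuhnFaceVertex w ρ) (Finset.mem_range.2 (Nat.lt_succ_self k))))).zero_le
    have hρ0 : 0 < (ρ 0 : ℕ) := Nat.pos_of_ne_zero fun h => hρ (Fin.ext h)
    have := (ρ 0).isLt
    simp only [Pi.neg_apply, kuhnFaceVertex] at h3
    rw [if_pos ⟨hρ0, by omega⟩] at h3
    omega

theorem alternating_cap (hR : 2 ≤ R) (w : Fin k → ℤ) (e : Equiv.Perm (Fin k)) :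
    alternating (fun v => (symmetricColor χ v : ℕ)) (colorSign χ) (k + 1)
      (((k + 1 : ℕ) : ZMod 2) + 1)
      ((kuhnSimplex w e).image fun v => (Fin.cons R v : Fin (k + 1) → ℤ)) +
    alternating (fun v => (symmetricColor χ v : ℕ)) (colorSign χ) (k + 1)
      (((k + 1 : ℕ) : ZMod 2) + 1)
      (((kuhnSimplex w e).image fun v => (Fin.cons R v : Fin (k + 1) → ℤ)).image fun v => -v) =
    rainbow (fun x => χ (R - 1, x)) (kuhnSimplex w e) := by
  set σ := (kuhnSimplex w e).image fun v => (Fin.cons R v : Fin (k + 1) → ℤ) with hσ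
  have hcard : σ.card = k + 1 := by
    rw [hσ, Finset.card_image_of_injective _ (cons_injective R), kuhnSimplex_card]
  have hpos : ∀ v : Fin k → ℤ, LexPos (Fin.cons R v : Fin (k + 1) → ℤ) := fun v =>
    lexPos_of_zero_lt (by rw [Fin.cons_zero]; omega)
  have hcol : ∀ v : Fin k → ℤ, symmetricColor χ (Fin.cons R v) = χ (R - 1, v) := by
    intro v
    rw [symmetricColor, if_pos (hpos v)]
    congr 1
    refine Prod.ext ?_ ?_
    · simp only [basePoint, Fin.cons_zero]
      omega
    · funext a
      simp [basePoint]
  have hneg : alternating (fun v => (symmetricColor χ v : ℕ)) (colorSign χ) (k + 1)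
      (((k + 1 : ℕ) : ZMod 2) + 1) (σ.image fun v => -v) = 0 := by
    by_contra hne
    obtain ⟨-, h2⟩ := lexPos_of_alternating_ne_zero
      (by rw [Finset.card_image_of_injective _ neg_injective, hcard]) hne
    have h3 := (h2 _ (Finset.mem_image_of_mem _ (Finset.mem_image_of_mem _
      (Finset.mem_image_of_mem (kuhnVertex w e) (Finset.mem_range.2 (Nat.succ_pos k)))))).zero_le
    simp only [Pi.neg_apply, Fin.cons_zero] at h3
    omega
  rw [hneg, add_zero]
  by_cases hinj : Set.InjOn (fun x => χ (R - 1, x)) (kuhnSimplex w e)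
  · rw [rainbow, if_pos hinj]
    refine alternating_eq_one hcard (fun v _ => (symmetricColor χ v).isLt) ?_ ?_
    · intro x hx y hy hxy
      obtain ⟨x, hx', rfl⟩ := Finset.mem_image.1 (Finset.mem_coe.1 hx)
      obtain ⟨y, hy', rfl⟩ := Finset.mem_image.1 (Finset.mem_coe.1 hy)
      simp only [hcol] at hxy
      rw [hinj hx' hy' (Fin.ext hxy)]
    · intro v hv
      obtain ⟨v, _, rfl⟩ := Finset.mem_image.1 hv
      rw [colorSign, lexSide_eq_zero_iff.2 (hpos v), zero_add, CharTwo.add_self_eq_zero,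
        add_assoc (((k + 1 : ℕ) : ZMod 2) + 1), CharTwo.add_self_eq_zero]
  · rw [rainbow_eq_zero hinj]
    by_contra hne
    obtain ⟨h1, -⟩ := lexPos_of_alternating_ne_zero hcard hne
    refine hinj fun x hx y hy hxy => cons_injective R (h1 ?_ ?_ ?_)
    · exact Finset.mem_coe.2 (Finset.mem_image_of_mem _ hx)
    · exact Finset.mem_coe.2 (Finset.mem_image_of_mem _ hy)
    · simp only [hcol]
      exact hxy

end core

/-! ### The parity contradiction -/

/-- Each missing color is that of a common neighbor: the nontop vertices and the upper facets are
translated into the middle layer, the two highest levels into the layer `1`, where their sums `k`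
and `k - 1` exceed `s`. -/
theorem SeparatesSandwich.sum_rainbow_cap {m : ℕ} {s : ℝ}
    {χ : ℤ × (Fin (m + 1) → ℤ) → Fin (m + 1 + 1)} {R₀ R : ℤ} (h : SeparatesSandwich s χ R₀)
    (hs : s ≤ ((m + 1 : ℕ) : ℝ) - 2) (hR : R₀ + 1 ≤ R) (w : Fin (m + 1) → ℤ) :
    ∑ ρ, rainbow (fun x => χ (R - 1, x)) (kuhnSimplex w ρ) = 0 := by
  have hfar : R₀ ≤ |R - 1| := le_trans (by omega) (le_abs_self _)
  push_cast at hs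
  refine sum_rainbow_kuhnSimplex (m := m) (fun x => χ (R - 1, x)) ?_ ?_ ?_
  · refine ⟨χ (-(R - 1), -w), fun x h1 h2 hne => h _ _ ?_ (Or.inl hfar)⟩
    rw [Prod.mk_add_mk, add_neg_cancel, ← sub_eq_add_neg]
    have hcube := mem_discreteCube_of_le h1 h2
    refine mem_sandwich_zero hcube (sum_lt_of_mem_discreteCube hcube ?_)
    by_contra hall
    push Not at hall
    refine hne (funext fun i => ?_)
    have h3 := (hcube i).resolve_left (hall i)
    simp only [Pi.sub_apply, Pi.add_apply, Pi.one_apply] at h3 ⊢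
    omega
  · intro i
    refine ⟨χ (-(R - 1), -w - Pi.single i 1), fun x h1 h2 hi => h _ _ ?_ (Or.inl hfar)⟩
    rw [Prod.mk_add_mk, add_neg_cancel]
    have hcube : x + (-w - Pi.single i 1) ∈ discreteCube (m + 1) := by
      intro a
      have := h1 a
      have := h2 a
      simp only [Pi.sub_apply, Pi.add_apply, Pi.one_apply, Pi.neg_apply, Pi.single_apply] at *
      split_ifs with ha
      · subst ha
        omega
      · omega
    refine mem_sandwich_zero hcube (sum_lt_of_mem_discreteCube hcube ⟨i, ?_⟩)
    simp [hi]
  · refine ⟨χ (1 - (R - 1), -w), h _ _ ?_ (Or.inl hfar), fun i => h _ _ ?_ (Or.inl hfar)⟩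
    · rw [Prod.mk_add_mk]
      have e1 : R - 1 + (1 - (R - 1)) = 1 := by ring
      have e2 : w + 1 + -w = 1 := by abel
      rw [e1, e2]
      refine mem_sandwich_one (fun i => Or.inr rfl) ?_
      simp
      linarith
    · rw [Prod.mk_add_mk]
      have e1 : R - 1 + (1 - (R - 1)) = 1 := by ring
      have e2 : coatom w i + -w = 1 - Pi.single i 1 := by unfold coatom; abel
      rw [e1, e2]
      refine mem_sandwich_one (fun a => ?_) ?_
      · by_cases ha : a = i
        · subst ha
          simp
        · simp [ha]
      · simp [Finset.sum_sub_distrib]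
        linarith

theorem not_separatesSandwich {k : ℕ} {s : ℝ} (hs : s ≤ (k : ℝ) - 2)
    (χ : ℤ × (Fin k → ℤ) → Fin (k + 1)) (R₀ : ℤ) : ¬ SeparatesSandwich s χ R₀ := by
  intro h
  cases k with
  | zero =>
    -- For `k = 0` there is a single color, and two far points with sum `(1, 0)` already contradict
    -- separation.
    refine h (|R₀|, 0) (1 - |R₀|, 0) ?_ (Or.inl ?_) (Subsingleton.elim (α := Fin 1) _ _)
    · have : ((|R₀|, 0) + (1 - |R₀|, 0) : ℤ × (Fin 0 → ℤ)) = (1, 0) := by simp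
      rw [this]
      refine mem_sandwich_one (fun i => i.elim0) ?_
      push_cast at hs
      simp
      linarith
    · simpa using le_abs_self R₀
  | succ m =>
    have hR1 := le_abs_self R₀
    have hR0 := abs_nonneg R₀
    -- The cap `v 0 = R` is colored by the layer `R - 1`, which must still be far: `R₀ + 1 ≤ R`.
    set R := |R₀| + 2 with hR
    have hfan := h.isFanLabelling (R := R) (by omega) (by omega)
    have key := hfan.hemisphere (by omega) (((m + 1 + 1 : ℕ) : ZMod 2) + 1)
      (kuhnSum_coboundary_alternating (by omega) hfan.cons _) fun σ => rfl
    rw [kuhnSideSum_congr (g := fun _ => 0) _ (by omega)] at key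
    · simp only [kuhnSum, alternating_cap (χ := χ) (by omega : 2 ≤ R)] at key
      rw [Finset.sum_comm, Finset.sum_eq_zero] at key
      · simp [kuhnSideSum] at key
      · exact fun w _ => h.sum_rainbow_cap hs (by omega) w
    · intro w ρ hρ hwR hw _
      have := h.alternating_side hs (R := R) (by omega) w ρ hρ hwR hw
      rw [this.1, this.2, add_zero]

/-! ### From the centerpole property to separating colorings -/

theorem IsGroupTotallyBounded.finite {G : Type*} [AddGroup G] [TopologicalSpace G]
    [DiscreteTopology G] {B : Set G} (h : IsGroupTotallyBounded B) : B.Finite := by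
  obtain ⟨F, hF, hB⟩ := h {0} (by simp)
  refine hF.subset fun x hx => ?_
  obtain ⟨g, hg, u, hu, rfl⟩ := Set.mem_iUnion₂.1 (hB hx)
  rw [Set.mem_singleton_iff.1 hu]
  simpa using hg

theorem isSymmetricAbout_setOf {G X : Type*} [AddCommGroup G] (χ : G → X) (c : G) (i : X) :
    IsSymmetricAbout {x | χ x = i ∧ χ (c + c - x) = i} c := by
  have key : ∀ x, χ x = i ∧ χ (c + c - x) = i →
      χ (c + c - x) = i ∧ χ (c + c - (c + c - x)) = i := by
    rintro x ⟨h1, h2⟩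
    exact ⟨h2, by rwa [sub_sub_cancel]⟩
  ext y
  constructor
  · rintro ⟨x, hx, rfl⟩
    exact ⟨c + c - x, key x hx, by simp only; abel⟩
  · rintro ⟨x, hx, rfl⟩
    exact ⟨c + c - x, key x hx, by simp only; abel⟩

/-- For each color `i`, the points of color `i` whose reflection also has color `i` form a
monochromatic symmetric set, so this set is finite. -/
theorem finite_of_not_isCenterpole {G : Type*} [AddCommGroup G] [TopologicalSpace G]
    [DiscreteTopology G] {n : ℕ} {C : Set G} {χ : G → Fin n}
    (h : ¬ ∃ S : Set G, ∃ c ∈ C, IsGroupUnbounded S ∧ IsMonochromatic χ S ∧ IsSymmetricAbout S c)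
    {c : G} (hc : c ∈ C) : {x | χ x = χ (c + c - x)}.Finite := by
  have h1 : ∀ i, {x | χ x = i ∧ χ (c + c - x) = i}.Finite := by
    intro i
    by_contra hinf
    exact h ⟨_, c, hc, fun hb => hinf hb.finite, ⟨i, fun x hx => hx.1⟩,
      isSymmetricAbout_setOf χ c i⟩
  refine (Set.finite_iUnion h1).subset fun x hx => Set.mem_iUnion.2 ⟨χ x, rfl, ?_⟩
  exact (show χ x = χ (c + c - x) from hx).symm

theorem discreteCube_finite (k : ℕ) : (discreteCube k).Finite := by
  refine (Set.finite_Icc (0 : Fin k → ℤ) 1).subset fun x hx => ⟨fun i => ?_, fun i => ?_⟩ <;>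
  · rcases hx i with h | h <;> simp [h]

theorem lowerSlice_finite (k : ℕ) (s : ℝ) : (lowerSlice k s).Finite :=
  (discreteCube_finite k).subset fun _ hx => hx.1

theorem upperSlice_finite (k : ℕ) (s : ℝ) : (upperSlice k s).Finite :=
  (discreteCube_finite k).subset fun _ hx => hx.1

theorem sandwich_finite (k : ℕ) (s : ℝ) : (sandwich k s).Finite :=
  (((Set.finite_singleton _).prod (lowerSlice_finite k s)).union
    ((Set.finite_singleton _).prod (lowerSlice_finite k k))).union
    ((Set.finite_singleton _).prod (upperSlice_finite k s))

theorem isCenterpole_sandwich {k : ℕ} {s : ℝ} (hs : s ≤ (k : ℝ) - 2) :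
    IsCenterpole (k + 1) (sandwich k s) := by
  intro χ
  by_contra hχ
  have hfin : (⋃ c ∈ sandwich k s, {x | χ x = χ (c + c - x)}).Finite :=
    (sandwich_finite k s).biUnion fun c hc => finite_of_not_isCenterpole hχ hc
  have hinj : Function.Injective fun u : ℤ × (Fin k → ℤ) => u + u := by
    intro u v h
    refine Prod.ext ?_ (funext fun i => ?_)
    · have := congrArg Prod.fst h
      simp only [Prod.fst_add] at this
      omega
    · have := congrFun (congrArg Prod.snd h) i
      simp only [Prod.snd_add, Pi.add_apply] at this
      omega
  obtain ⟨B, hB⟩ := ((hfin.preimage hinj.injOn).image fun u => |u.1| + ∑ i, |u.2 i|).bddAbove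
  -- Doubling turns reflection at `c = u + v` into an exchange: `2c - 2u = 2v`. The bound `B`
  -- confines the finitely many exceptional `u`.
  refine not_separatesSandwich hs (fun u => χ (u + u)) (B + 1) fun u v huv hfar heq => ?_
  have hu : u ∈ (fun u : ℤ × (Fin k → ℤ) => u + u) ⁻¹'
      (⋃ c ∈ sandwich k s, {x | χ x = χ (c + c - x)}) := by
    refine Set.mem_iUnion₂.2 ⟨u + v, huv, ?_⟩
    have e : u + v + (u + v) - (u + u) = v + v := by abel
    simp only [Set.mem_ofPred_eq, e]
    exact heq
  have hle := hB (Set.mem_image_of_mem _ hu)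
  have hnn : ∀ i ∈ Finset.univ, 0 ≤ |u.2 i| := fun i _ => abs_nonneg _
  rcases hfar with h | ⟨i, h⟩
  · have := Finset.sum_nonneg hnn
    omega
  · have := Finset.single_le_sum hnn (Finset.mem_univ i)
    have := abs_nonneg u.1
    omega

/-! ### Cardinality of the sandwich -/

/-- The point of the cube whose coordinates equal to `1` form the set `T`. -/
def cubePoint {k : ℕ} (T : Finset (Fin k)) : Fin k → ℤ := fun i => if i ∈ T then 1 else 0

theorem cubePoint_injective (k : ℕ) : Function.Injective (cubePoint (k := k)) := by
  intro S T h
  ext i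
  have := congrFun h i
  unfold cubePoint at this
  split_ifs at this <;> simp_all

theorem sum_cubePoint {k : ℕ} (T : Finset (Fin k)) : ∑ i, cubePoint T i = T.card := by
  simp [cubePoint]

theorem cubePoint_mem {k : ℕ} (T : Finset (Fin k)) : cubePoint T ∈ discreteCube k := by
  intro i
  unfold cubePoint
  split_ifs
  · exact Or.inr rfl
  · exact Or.inl rfl

theorem exists_cubePoint_eq {k : ℕ} {x : Fin k → ℤ} (hx : x ∈ discreteCube k) :
    ∃ T, cubePoint T = x := by
  refine ⟨Finset.univ.filter fun i => x i = 1, funext fun i => ?_⟩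
  rcases hx i with h | h <;> simp [cubePoint, h]

open Classical in
theorem ncard_setOf_discreteCube (k : ℕ) (P : ℝ → Prop) :
    {x | x ∈ discreteCube k ∧ P ((∑ i, x i : ℤ) : ℝ)}.ncard =
      (Finset.univ.filter fun T : Finset (Fin k) => P T.card).card := by
  have : {x | x ∈ discreteCube k ∧ P ((∑ i, x i : ℤ) : ℝ)} =
      cubePoint '' (Finset.univ.filter fun T : Finset (Fin k) => P T.card) := by
    ext x
    simp only [Set.mem_ofPred_eq, Set.mem_image, Finset.coe_filter, Finset.mem_univ, true_and]
    constructor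
    · rintro ⟨hx, hP⟩
      obtain ⟨T, rfl⟩ := exists_cubePoint_eq hx
      rw [sum_cubePoint] at hP
      exact ⟨T, by simpa using hP, rfl⟩
    · rintro ⟨T, hP, rfl⟩
      rw [sum_cubePoint]
      exact ⟨cubePoint_mem T, by simpa using hP⟩
  rw [this, Set.ncard_image_of_injective _ (cubePoint_injective k), Set.ncard_coe_finset]

open Classical in
theorem card_filter_card_eq (k : ℕ) (s : ℝ) :
    (Finset.univ.filter fun T : Finset (Fin k) => (T.card : ℝ) = s).card = binom k s := by
  unfold binom
  split_ifs with h
  · rw [h, Nat.floor_natCast]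
    have : (Finset.univ.filter fun T : Finset (Fin k) => (T.card : ℝ) = ((⌊s⌋₊ : ℕ) : ℝ)) =
        Finset.powersetCard ⌊s⌋₊ Finset.univ := by
      ext T
      simp [Finset.mem_powersetCard]
    rw [this, Finset.card_powersetCard, Finset.card_univ, Fintype.card_fin]
  · rw [Finset.card_eq_zero, Finset.filter_eq_empty_iff]
    rintro T - rfl
    exact h (by rw [Nat.floor_natCast])

theorem ncard_slices (k : ℕ) (s : ℝ) :
    (lowerSlice k s).ncard + (upperSlice k s).ncard + binom k s = 2 ^ k := by
  classical
  have h1 := ncard_setOf_discreteCube k fun x => x < s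
  have h2 := ncard_setOf_discreteCube k fun x => s < x
  unfold lowerSlice upperSlice
  rw [h1, h2, ← card_filter_card_eq, ← Finset.card_union_of_disjoint,
    ← Finset.card_union_of_disjoint]
  · have : (Finset.univ.filter fun T : Finset (Fin k) => (T.card : ℝ) < s) ∪
        (Finset.univ.filter fun T : Finset (Fin k) => s < (T.card : ℝ)) ∪
        (Finset.univ.filter fun T : Finset (Fin k) => (T.card : ℝ) = s) = Finset.univ := by
      ext T
      simp only [Finset.mem_union, Finset.mem_filter, Finset.mem_univ, true_and, iff_true]
      rcases lt_trichotomy (T.card : ℝ) s with h | h | h <;> tauto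
    rw [this]
    simp
  · rw [Finset.disjoint_left]
    intro T
    simp only [Finset.mem_union, Finset.mem_filter, Finset.mem_univ, true_and]
    rintro (h | h) h'
    · exact h.ne h'
    · exact h.ne' h'
  · rw [Finset.disjoint_left]
    intro T
    simp only [Finset.mem_filter, Finset.mem_univ, true_and]
    exact fun h h' => lt_asymm h h'

theorem ncard_lowerSlice_top (k : ℕ) : (lowerSlice k (k : ℝ)).ncard + 1 = 2 ^ k := by
  have h := ncard_slices k k
  have h1 : binom k (k : ℝ) = 1 := by simp [binom]
  have h2 : upperSlice k (k : ℝ) = ∅ := by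
    rw [Set.eq_empty_iff_forall_notMem]
    rintro x ⟨hx, hs⟩
    obtain ⟨T, rfl⟩ := exists_cubePoint_eq hx
    rw [sum_cubePoint] at hs
    have := Finset.card_le_univ T
    rw [Fintype.card_fin] at this
    have h3 : k < T.card := by exact_mod_cast hs
    omega
  rwa [h1, h2, Set.ncard_empty, add_zero] at h

theorem ncard_singleton_prod {α β : Type*} (a : α) (X : Set β) :
    (({a} : Set α) ×ˢ X).ncard = X.ncard := by
  rw [Set.singleton_prod, Set.ncard_image_of_injective _ (Prod.mk_right_injective a)]

theorem ncard_sandwich (k : ℕ) (s : ℝ) :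
    (sandwich k s).ncard + 1 + binom k s = 2 ^ (k + 1) := by
  have hdisj : ∀ (a b : ℤ) (X Y : Set (Fin k → ℤ)), a ≠ b →
      Disjoint (({a} : Set ℤ) ×ˢ X) (({b} : Set ℤ) ×ˢ Y) := by
    intro a b X Y hab
    rw [Set.disjoint_left]
    rintro p ⟨h1, -⟩ ⟨h2, -⟩
    exact hab ((Set.mem_singleton_iff.1 h1).symm.trans (Set.mem_singleton_iff.1 h2))
  have f1 := (Set.finite_singleton (-1 : ℤ)).prod (lowerSlice_finite k s)
  have f2 := (Set.finite_singleton (0 : ℤ)).prod (lowerSlice_finite k k)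
  have f3 := (Set.finite_singleton (1 : ℤ)).prod (upperSlice_finite k s)
  have h1 := ncard_slices k s
  have h2 := ncard_lowerSlice_top k
  rw [sandwich, Set.ncard_union_eq
    (Set.disjoint_union_left.2 ⟨hdisj _ _ _ _ (by norm_num), hdisj _ _ _ _ (by norm_num)⟩)
    (f1.union f2) f3, Set.ncard_union_eq (hdisj _ _ _ _ (by norm_num)) f1 f2,
    ncard_singleton_prod, ncard_singleton_prod, ncard_singleton_prod, pow_succ]
  omega

theorem theorem1p4 (k : ℕ) (s : ℝ) (hs : s ≤ (k : ℝ) - 2) :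
    IsCenterpole (k + 1) (sandwich k s) ∧
      ((sandwich k s).ncard : ℤ) = 2 ^ (k + 1) - 1 - (binom k s : ℤ) := by
  refine ⟨isCenterpole_sandwich hs, ?_⟩
  have h : (((sandwich k s).ncard + 1 + binom k s : ℕ) : ℤ) = ((2 ^ (k + 1) : ℕ) : ℤ) := by
    rw [ncard_sandwich]
  push_cast at h
  linarith
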